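/- Let $P$ be a probability measure on a measurable space $\mathcal X$ and let $k:\mathcal X\times\mathcal X\to\mathbb R$ be a kernel with $k(x,x')=\sum_{i\ge 1}\lambda_i\mu_i(x)\mu_i(x')$ for all $x,x'$, where $\lambda_1\ge\lambda_2\ge\cdots\ge 0$ and $\mu_1,\mu_2,\dots$ are the eigenvalues and the $L^2(P)$-orthonormal eigenfunctions of the integral operator $T_kf=\int k(\cdot,z)f(z)\,dP(z)$. Let $\kappa$ be such that $k(x,x)\le\kappa^2$ for $P$-almost all $x$. Let $s(\lambda)=\sum_{p\ge 1}\pi_p\lambda^p$ with $\pi_p\ge 0$, and let $R\in[0,\infty]$ be the radius of convergence of this series. Let $k_s(x,x')=\sum_i s(\lambda_i)\mu_i(x)\mu_i(x')$. Let $m\ge 0$, $n\ge 1$, and let $x_1,\dots,x_{m+n}$ be i.i.d. samples from $P$, the last $n$ of which, $\tilde x_i=x_{m+i}$, carry labels $y=(y_1,\dots,y_n)\in\mathbb R^n$. Let $G_k=(k(x_i,x_j))_{i,j\le m+n}$ and $v_k(x)=(k(x,x_i))_{i\le m+n}$, put $\hat k^1=k$ and $\hat k^p(x,x')=(m+n)^{-(p-1)}\,v_k(x)^\top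 G_k^{p-2}v_k(x')$ for $p\ge 2$, and $\hat k_s=\sum_{p\ge 1}\pi_p\hat k^p$. For $\beta_n>0$ and $K\in\{k_s,\hat k_s\}$ let $$f_K(x)=v_{K,n}(x)^\top\,(G_{K,n}+n\beta_n I_n)^{-1}y,\qquad v_{K,n}(x)=(K(x,\tilde x_i))_{i\le n},\quad G_{K,n}=(K(\tilde x_i,\tilde x_j))_{i,j\le n},$$ be the kernel ridge regression predictor with kernel $K$, and write $\tilde f=f_{k_s}$ and $\hat f=f_{\hat k_s}$. Let $\hat\lambda_1$ be the largest eigenvalue of $G_k/(m+n)$ and $\lambda_{\max}=\max\{\lambda_1,\hat\lambda_1\}$. Then, for every $\delta\in(0,1)$, with probability at least $1-\delta$ over $x_1,\dots,x_{m+n}$ the following holds, simultaneously for all $y\in\mathbb R^n$: if $\lambda_{\max}<R$ (which is automatic when $R=\infty$), then $$\|\hat f-\tilde f\|_{L^2(P)}^2\le 8\,s(\lambda_{\max})\left.\frac{d}{d\lambda}\left(\frac{s(\lambda)}{\lambda}\right)\right|_{\lambda=\lambda_{\max}}\frac{\beta_n^{-2}\kappa^4}{\sqrt{m+n}}\left(2+\sqrt{2\log\frac1\delta}\right)\frac{\|y\|_2^2}{n},$$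 where the right-hand side is read as $0$ if $\lambda_{\max}=0$. -/

import Mathlib

open MeasureTheory Matrix

noncomputable section

namespace STKR

variable {X : Type*}

/-- Spectral data of the integral operator `T_k f = ∫ k(·, z) f(z) dP(z)` on `L²(P)`:
`lam 0 ≥ lam 1 ≥ ⋯ ≥ 0` are the eigenvalues with orthonormal eigenfunctions `e 0, e 1, …`, and
`k(x, z) = ∑ i, lam i * e i x * e i z` holds pointwise. Orthonormality and the eigenvalue equation
are only required where `lam i ≠ 0`, so that finite rank kernels and finite-dimensional `L²(P)`
are included (pad `lam` by zeros). -/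
structure IsSpectralExpansion [MeasurableSpace X] (P : Measure X) (k : X → X → ℝ)
    (lam : ℕ → ℝ) (e : ℕ → X → ℝ) : Prop where
  nonneg : ∀ i, 0 ≤ lam i
  antitone : Antitone lam
  measurable : ∀ i, Measurable (e i)
  memLp : ∀ i, MemLp (e i) 2 P
  orthonormal : ∀ i j, lam i ≠ 0 → lam j ≠ 0 →
    ∫ x, e i x * e j x ∂P = if i = j then 1 else 0
  eigen : ∀ i, lam i ≠ 0 → ∀ᵐ x ∂P, ∫ z, k x z * e i z ∂P = lam i * e i x
  hasSum : ∀ x z, HasSum (fun i => lam i * e i x * e i z) (k x z)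

/-- `s(t) = ∑_{p ≥ 1} c_p t^p` (the value `c 0` is never used). -/
def transform (c : ℕ → ℝ) (t : ℝ) : ℝ := ∑' p : ℕ, c (p + 1) * t ^ (p + 1)

/-- `t` lies strictly inside the disc of convergence of `∑_{p ≥ 1} c_p t^p`
(for `t ≥ 0` and `c_p ≥ 0`). -/
def InsideConvergence (c : ℕ → ℝ) (t : ℝ) : Prop :=
  ∃ r : ℝ, t < r ∧ Summable fun p : ℕ => c (p + 1) * r ^ (p + 1)

/-- The spectrally transformed kernel `k_s(x, z) = ∑ i, s(lam i) * e i x * e i z`. -/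
def stk (s : ℝ → ℝ) (lam : ℕ → ℝ) (e : ℕ → X → ℝ) (x z : X) : ℝ :=
  ∑' i, s (lam i) * e i x * e i z

/-- The Gram matrix of a kernel on a finite family of points. -/
def gram {N : ℕ} (k : X → X → ℝ) (x : Fin N → X) : Matrix (Fin N) (Fin N) ℝ :=
  Matrix.of fun i j => k (x i) (x j)

/-- The vector `v_k(z)`, with entries `k(z, x_i)`. -/
def kvec {N : ℕ} (k : X → X → ℝ) (x : Fin N → X) (z : X) : Fin N → ℝ :=
  fun i => k z (x i)

/-- The Monte Carlo estimate of the power kernel `k^p`, `p ≥ 1`: it is `k` for `p = 1` and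
`v_k(u)ᵀ G_k^(p-2) v_k(w) / N^(p-1)` for `p ≥ 2`. The value at `p = 0` is never used. -/
def empiricalPower {N : ℕ} (k : X → X → ℝ) (x : Fin N → X) : ℕ → X → X → ℝ
  | 0 => fun _ _ => 0
  | 1 => k
  | p + 2 => fun u w =>
      (kvec k x u ⬝ᵥ ((gram k x) ^ p *ᵥ kvec k x w)) / (N : ℝ) ^ (p + 1)

/-- The estimate of `k_s`: the sum over `p ≥ 1` of `c_p` times the estimate of `k^p`. -/
def empiricalStk {N : ℕ} (c : ℕ → ℝ) (k : X → X → ℝ) (x : Fin N → X) (u w : X) : ℝ :=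
  ∑' p : ℕ, c (p + 1) * empiricalPower k x (p + 1) u w

/-- The kernel ridge regression predictor `z ↦ v_{K,n}(z)ᵀ (G_{K,n} + n β I)⁻¹ y`. -/
def krr {n : ℕ} (K : X → X → ℝ) (β : ℝ) (x : Fin n → X) (y : Fin n → ℝ) (z : X) : ℝ :=
  kvec K x z ⬝ᵥ
    ((gram K x + ((n : ℝ) * β) • (1 : Matrix (Fin n) (Fin n) ℝ))⁻¹ *ᵥ y)

/-- The largest (real) eigenvalue of a square matrix, here a symmetric one. -/
def largestEigenvalue {N : ℕ} (A : Matrix (Fin N) (Fin N) ℝ) : ℝ :=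
  sSup {t : ℝ | Module.End.HasEigenvalue (Matrix.toLin' A) t}

/-- `max {λ₁, λ̂₁}`, with `λ̂₁` the largest eigenvalue of `G_k / N`. -/
def lamMax {N : ℕ} (k : X → X → ℝ) (lam₁ : ℝ) (x : Fin N → X) : ℝ :=
  max lam₁ (largestEigenvalue ((N : ℝ)⁻¹ • gram k x))

/-- The labeled points, which are the last `n` of the `m + n` samples. -/
def labeled {m n : ℕ} (x : Fin (m + n) → X) : Fin n → X := fun i => x (Fin.natAdd m i)

end STKR

end

/-! Put φ(x) = (√λ_i e_i(x))_i in ℓ², so that k(x,z) = ⟨φ(x), φ(z)⟩. Let T = E[φ ⊗ φ], which is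
diagonal with entries λ_i, let T̂ be its average over all N = m+n samples, and let g(t) = s(t)/t = ∑
c_{p+1} t^p. Then k_s(x,z) = ⟨φ(x), g(T)φ(z)⟩, and since each application of T̂ multiplies
coefficients on the φ(x_i) by G_k/N, also k̂_s(x,z) = ⟨φ(x), g(T̂)φ(z)⟩. The two predictors thus
differ only through S = g(T) and S' = g(T̂).

Randomness enters only through Δ = ‖T̂ - T‖. The vectors φ(x) ⊗ φ(x) live in a Hilbert space and
have norm at most κ² almost surely, so McDiarmid's inequality for the norm of their centred sum,
with a second moment bound on its mean, gives Δ ≤ κ²/√N (2 + √(2 log(1/δ))). This event does not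
involve y.

The rest is deterministic. Both operators have norm at most L = λ_max, so D = ‖S' - S‖ is at most
g'(L)Δ and also at most 2g(L). If u, v are the ridge coefficients for k̂_s, k_s and U, V the
corresponding combinations of labeled features, the error is z ↦ ⟨φ(z), a + b⟩ with a = (S' - S)U
and b = S(U - V), and its squared L² norm is the quadratic form of T at a + b. The a-part is at most
L D²‖U‖². The b-part uses STS ≤ s(λ₁)S and the energy ⟨U - V, S(U - V)⟩, which the ridge equations
bound linearly in D. The key lemmas are `exists_norm_empiricalCovariance_sub_le`,
`norm_quotientSeries_sub_le`, `ridge_perturbation` and `krr_error_le`. -/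

namespace STKR

/-! ### McDiarmid's inequality and concentration of means in a Hilbert space. -/

section Concentration

variable {X : Type*} [MeasurableSpace X]

/-- Fubini for a finite power of a probability measure, integrating out the first coordinate. -/
theorem integral_pi_fin_succ (P : Measure X) [IsProbabilityMeasure P] {N : ℕ}
    {F : (Fin (N + 1) → X) → ℝ} (hF : Measurable F) {M : ℝ} (hM : ∀ x, |F x| ≤ M) :
    ∫ x, F x ∂(Measure.pi fun _ : Fin (N + 1) => P) =
      ∫ x, ∫ a, F (Fin.cons a x) ∂P ∂(Measure.pi fun _ : Fin N => P) := by
  have hmp := (measurePreserving_piFinSuccAbove (fun _ : Fin (N + 1) => P) 0).symm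
  rw [← hmp.integral_comp' F, integral_prod_symm]
  · simp [MeasurableEquiv.piFinSuccAbove, Fin.insertNthEquiv]
  · refine Integrable.of_bound (C := M) ?_ (Filter.Eventually.of_forall fun z => hM _)
    exact (hF.comp (MeasurableEquiv.measurable _)).aestronglyMeasurable

theorem measurable_fin_cons {N : ℕ} :
    Measurable fun z : X × (Fin N → X) => (Fin.cons z.1 z.2 : Fin (N + 1) → X) := by
  refine measurable_pi_iff.2 fun i => ?_
  refine Fin.cases ?_ (fun j => ?_) i
  · simpa using measurable_fst
  · simp only [Fin.cons_succ]
    exact (measurable_pi_apply j).comp measurable_snd 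

/-- **McDiarmid's inequality**, at the level of moment generating functions. -/
theorem mgf_le_of_bounded_differences (P : Measure X) [IsProbabilityMeasure P] (b t : ℝ) {M : ℝ} :
    ∀ (N : ℕ) (f : (Fin N → X) → ℝ), Measurable f → (∀ x, |f x| ≤ M) →
      (∀ x i a, |f (Function.update x i a) - f x| ≤ b) →
      ∫ x, Real.exp (t * (f x - ∫ x, f x ∂(Measure.pi fun _ : Fin N => P)))
        ∂(Measure.pi fun _ : Fin N => P) ≤ Real.exp (N * ((b / 2) ^ 2 * t ^ 2 / 2)) := by
  intro N
  induction N with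
  | zero =>
    intro f _ _ _
    have h : ∀ x, f x = f (fun i => i.elim0) := fun x => congrArg f (Subsingleton.elim _ _)
    simp [h]
  | succ N ih =>
    intro f hf hM hb
    set π := Measure.pi fun _ : Fin N => P
    let g : (Fin N → X) → ℝ := fun x => ∫ a, f (Fin.cons a x) ∂P
    have hM0 : 0 ≤ M := by
      obtain ⟨a⟩ := P.nonempty_of_neZero
      exact (abs_nonneg _).trans (hM fun _ => a)
    have hfc : Measurable fun z : X × (Fin N → X) => f (Fin.cons z.1 z.2) :=
      hf.comp measurable_fin_cons
    have hfx : ∀ x : Fin N → X, Measurable fun a => f (Fin.cons a x) := fun x =>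
      hfc.comp (measurable_id.prodMk measurable_const)
    have hfi : ∀ x : Fin N → X, Integrable (fun a => f (Fin.cons a x)) P := fun x =>
      Integrable.of_bound (C := M) (hfx x).aestronglyMeasurable
        (Filter.Eventually.of_forall fun a => hM _)
    have hg : Measurable g := (hfc.stronglyMeasurable.integral_prod_left (μ := P)).measurable
    have hgM : ∀ x, |g x| ≤ M := fun x => by
      have := norm_integral_le_of_norm_le_const (μ := P) (f := fun a => f (Fin.cons a x))
        (Filter.Eventually.of_forall fun a => hM _)
      simpa using this
    have hgb : ∀ x i a, |g (Function.update x i a) - g x| ≤ b := fun x i a => by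
      have h1 : g (Function.update x i a) - g x =
          ∫ c, (f (Fin.cons c (Function.update x i a)) - f (Fin.cons c x)) ∂P :=
        (integral_sub (hfi _) (hfi _)).symm
      rw [h1]
      have := norm_integral_le_of_norm_le_const (μ := P) (C := b)
        (f := fun c => f (Fin.cons c (Function.update x i a)) - f (Fin.cons c x))
        (Filter.Eventually.of_forall fun c => by
          rw [Fin.cons_update]; exact hb _ _ _)
      simpa using this
    have hint : ∫ x, f x ∂(Measure.pi fun _ : Fin (N + 1) => P) = ∫ x, g x ∂π :=
      integral_pi_fin_succ P hf hM
    rw [hint]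
    set μ := ∫ x, g x ∂π with hμ
    have hμM : |μ| ≤ M := by
      have := norm_integral_le_of_norm_le_const (μ := π) (f := g)
        (Filter.Eventually.of_forall hgM)
      simpa using this
    have hexp : ∀ u v : ℝ, |u| ≤ M → |v| ≤ M →
        |Real.exp (t * (u - v))| ≤ Real.exp (|t| * (2 * M)) := by
      intro u v hu hv
      rw [abs_of_pos (Real.exp_pos _), Real.exp_le_exp]
      refine (le_abs_self _).trans ?_
      rw [abs_mul]
      refine mul_le_mul_of_nonneg_left ((abs_sub _ _).trans ?_) (abs_nonneg _)
      linarith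
    rw [integral_pi_fin_succ P (by fun_prop) (fun x => hexp _ _ (hM x) hμM)]
    have hinner : ∀ x, ∫ a, Real.exp (t * (f (Fin.cons a x) - μ)) ∂P ≤
        Real.exp ((b / 2) ^ 2 * t ^ 2 / 2) * Real.exp (t * (g x - μ)) := by
      intro x
      have hdiff : ∀ a a', f (Fin.cons a x) - f (Fin.cons a' x) ≤ b := fun a a' => by
        have := hb (Fin.cons a' x) 0 a
        rw [Fin.update_cons_zero] at this
        exact (le_abs_self _).trans this
      have : Nonempty X := P.nonempty_of_neZero
      have hbdd : BddBelow (Set.range fun a => f (Fin.cons a x)) :=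
        ⟨-M, by rintro _ ⟨a, rfl⟩; exact (abs_le.1 (hM _)).1⟩
      -- Hoeffding's lemma: with the other coordinates frozen, the values lie in an interval of
      -- length `b` starting at their infimum.
      have hsub := ProbabilityTheory.hasSubgaussianMGF_of_mem_Icc (μ := P)
        (X := fun a => f (Fin.cons a x)) (a := ⨅ a, f (Fin.cons a x))
        (b := (⨅ a, f (Fin.cons a x)) + b) (hfx x).aemeasurable
        (Filter.Eventually.of_forall fun a => ⟨ciInf_le hbdd a, by
          have : f (Fin.cons a x) - b ≤ ⨅ a, f (Fin.cons a x) :=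
            le_ciInf fun a' => by linarith [hdiff a a']
          linarith⟩)
      have h2 := hsub.mgf_le t
      simp only [ProbabilityTheory.mgf] at h2
      have h3 : ∀ a, Real.exp (t * (f (Fin.cons a x) - μ)) =
          Real.exp (t * (f (Fin.cons a x) - ∫ a, f (Fin.cons a x) ∂P)) *
            Real.exp (t * (g x - μ)) := fun a => by
        rw [← Real.exp_add]; congr 1; simp only [g]; ring
      simp_rw [h3]
      rw [integral_mul_const]
      refine mul_le_mul_of_nonneg_right (h2.trans (le_of_eq ?_)) (Real.exp_pos _).le
      congr 1
      simp [div_pow]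
    have hgi : Integrable (fun x => Real.exp (t * (g x - μ))) π :=
      Integrable.of_bound (C := Real.exp (|t| * (2 * M))) (by fun_prop)
        (Filter.Eventually.of_forall fun x => hexp _ _ (hgM x) hμM)
    calc _ ≤ ∫ x, Real.exp ((b / 2) ^ 2 * t ^ 2 / 2) * Real.exp (t * (g x - μ)) ∂π := by
          refine integral_mono_of_nonneg (Filter.Eventually.of_forall fun x =>
            integral_nonneg fun a => (Real.exp_pos _).le) (hgi.const_mul _)
            (Filter.Eventually.of_forall hinner)
      _ ≤ Real.exp ((b / 2) ^ 2 * t ^ 2 / 2) * Real.exp (N * ((b / 2) ^ 2 * t ^ 2 / 2)) := by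
          rw [integral_const_mul]
          exact mul_le_mul_of_nonneg_left (ih g hg hgM hgb) (Real.exp_pos _).le
      _ = _ := by rw [← Real.exp_add]; congr 1; push_cast; ring

/-- **McDiarmid's inequality**: the upper tail of a function with bounded differences. -/
theorem measure_ge_le_of_bounded_differences (P : Measure X) [IsProbabilityMeasure P] {b M : ℝ}
    {N : ℕ} {f : (Fin N → X) → ℝ} (hf : Measurable f) (hM : ∀ x, |f x| ≤ M)
    (hb : ∀ x i a, |f (Function.update x i a) - f x| ≤ b) {ε : ℝ} (hε : 0 ≤ ε) :
    (Measure.pi fun _ : Fin N => P).real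
      {x | ε ≤ f x - ∫ x, f x ∂(Measure.pi fun _ : Fin N => P)} ≤
        Real.exp (-ε ^ 2 / (2 * (N * (b / 2) ^ 2))) := by
  set π := Measure.pi fun _ : Fin N => P
  have hμM : |∫ x, f x ∂π| ≤ M := by
    have := norm_integral_le_of_norm_le_const (μ := π) (f := f)
      (Filter.Eventually.of_forall hM)
    simpa using this
  have h : ProbabilityTheory.HasSubgaussianMGF (fun x => f x - ∫ x, f x ∂π)
      ⟨N * (b / 2) ^ 2, by positivity⟩ π := by
    refine ⟨fun t => ?_, fun t => ?_⟩
    · refine Integrable.of_bound (C := Real.exp (|t| * (2 * M))) (by fun_prop)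
        (Filter.Eventually.of_forall fun x => ?_)
      rw [Real.norm_eq_abs, abs_of_pos (Real.exp_pos _), Real.exp_le_exp]
      refine (le_abs_self _).trans ?_
      rw [abs_mul]
      refine mul_le_mul_of_nonneg_left ((abs_sub _ _).trans ?_) (abs_nonneg _)
      linarith [hM x]
    · refine (mgf_le_of_bounded_differences P b t N f hf hM hb).trans (le_of_eq ?_)
      congr 1
      change _ = (N * (b / 2) ^ 2) * t ^ 2 / 2
      ring
  exact h.measure_ge_le hε

theorem norm_sum_comp_le {X H : Type*} [NormedAddCommGroup H] {ξ : X → H} {M : ℝ}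
    (hM : ∀ x, ‖ξ x‖ ≤ M) {N : ℕ} (x : Fin N → X) :
    ‖∑ i, ξ (x i)‖ ≤ N * M := by
  refine (norm_sum_le _ _).trans ?_
  simpa using Finset.sum_le_sum fun i (_ : i ∈ Finset.univ) => hM (x i)

theorem stronglyMeasurable_sum_comp {H : Type*} [NormedAddCommGroup H] {ξ : X → H}
    (hξ : StronglyMeasurable ξ) {N : ℕ} :
    StronglyMeasurable fun x : Fin N → X => ∑ i, ξ (x i) :=
  Finset.stronglyMeasurable_fun_sum _ fun i _ => hξ.comp_measurable (measurable_pi_apply i)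

variable {H : Type*} [NormedAddCommGroup H] [InnerProductSpace ℝ H]

/-- The second moment of a sum of independent centred bounded vectors. -/
theorem integral_norm_sum_sq_le [CompleteSpace H] (P : Measure X) [IsProbabilityMeasure P]
    {ξ : X → H} (hξ : StronglyMeasurable ξ) {M : ℝ} (hM : ∀ x, ‖ξ x‖ ≤ M)
    (h0 : ∫ x, ξ x ∂P = 0) (N : ℕ) :
    ∫ x, ‖∑ i, ξ (x i)‖ ^ 2 ∂(Measure.pi fun _ : Fin N => P) ≤ N * M ^ 2 := by
  induction N with
  | zero => simp
  | succ N ih =>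
    have hM0 : 0 ≤ M := by
      obtain ⟨a⟩ := P.nonempty_of_neZero
      exact (norm_nonneg _).trans (hM a)
    have hmeas : ∀ N : ℕ, Measurable fun x : Fin N → X => ‖∑ i, ξ (x i)‖ ^ 2 := fun N =>
      (stronglyMeasurable_sum_comp hξ).norm.measurable.pow_const 2
    have hbd : ∀ (N : ℕ) (x : Fin N → X), |‖∑ i, ξ (x i)‖ ^ 2| ≤ (N * M) ^ 2 := fun N x => by
      rw [abs_of_nonneg (by positivity)]
      exact pow_le_pow_left₀ (norm_nonneg _) (norm_sum_comp_le hM x) 2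
    rw [integral_pi_fin_succ P (hmeas _) (hbd _)]
    have hξi : Integrable ξ P := Integrable.of_bound (C := M) hξ.aestronglyMeasurable
      (Filter.Eventually.of_forall hM)
    have hξ2 : Integrable (fun a => ‖ξ a‖ ^ 2) P := by
      refine Integrable.of_bound (C := M ^ 2) (hξ.norm.measurable.pow_const 2).aestronglyMeasurable
        (Filter.Eventually.of_forall fun a => ?_)
      rw [Real.norm_of_nonneg (by positivity)]
      exact pow_le_pow_left₀ (norm_nonneg _) (hM a) 2
    have hinner : ∀ x : Fin N → X, ∫ a, ‖∑ i, ξ ((Fin.cons a x : Fin (N + 1) → X) i)‖ ^ 2 ∂P ≤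
        M ^ 2 + ‖∑ i, ξ (x i)‖ ^ 2 := fun x => by
      simp only [Fin.sum_univ_succ, Fin.cons_zero, Fin.cons_succ]
      set S := ∑ i, ξ (x i)
      have hi : Integrable (fun a => inner ℝ S (ξ a)) P := hξi.const_inner S
      -- The cross term vanishes because the new summand is centred, so each coordinate adds at most
      -- `M ^ 2`.
      have hz : ∫ a, inner ℝ S (ξ a) ∂P = 0 := by
        rw [integral_inner hξi, h0, inner_zero_right]
      have : ∀ a, ‖ξ a + S‖ ^ 2 = ‖ξ a‖ ^ 2 + 2 * inner ℝ S (ξ a) + ‖S‖ ^ 2 := fun a => by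
        rw [norm_add_sq_real, real_inner_comm]
      simp_rw [this]
      have hadd : Integrable (fun a => ‖ξ a‖ ^ 2 + 2 * inner ℝ S (ξ a)) P :=
        hξ2.add (hi.const_mul 2)
      rw [integral_add hadd (integrable_const _), integral_add hξ2 (hi.const_mul 2),
        integral_const_mul, hz]
      have : ∫ a, ‖ξ a‖ ^ 2 ∂P ≤ M ^ 2 := by
        have := integral_mono hξ2 (integrable_const (M ^ 2))
          fun a => pow_le_pow_left₀ (norm_nonneg _) (hM a) 2
        simpa using this
      simpa using this
    have hSi : Integrable (fun x : Fin N → X => ‖∑ i, ξ (x i)‖ ^ 2)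
        (Measure.pi fun _ : Fin N => P) :=
      Integrable.of_bound (C := (N * M) ^ 2) (hmeas N).aestronglyMeasurable
        (Filter.Eventually.of_forall (hbd N))
    calc _ ≤ ∫ x : Fin N → X, (M ^ 2 + ‖∑ i, ξ (x i)‖ ^ 2) ∂(Measure.pi fun _ : Fin N => P) :=
          integral_mono_of_nonneg (Filter.Eventually.of_forall fun x =>
            integral_nonneg fun a => by positivity) ((integrable_const _).add hSi)
            (Filter.Eventually.of_forall hinner)
      _ ≤ _ := by
          rw [integral_add (integrable_const _) hSi]
          push_cast
          simp only [integral_const, probReal_univ, one_smul]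
          linarith

/-- Concentration of the empirical mean of bounded random vectors in a Hilbert space. -/
theorem exists_norm_sum_le [CompleteSpace H] (P : Measure X) [IsProbabilityMeasure P]
    {ψ : X → H} (hψ : StronglyMeasurable ψ) {M : ℝ} (hM0 : 0 ≤ M) (hM : ∀ x, ‖ψ x‖ ≤ M)
    {N : ℕ} (hN : 0 < N) {δ : ℝ} (hδ₀ : 0 < δ) (hδ₁ : δ < 1) :
    ∃ E : Set (Fin N → X), MeasurableSet E ∧
      1 - δ ≤ (Measure.pi fun _ : Fin N => P).real E ∧
      ∀ x ∈ E, ‖(N : ℝ)⁻¹ • ∑ i, ψ (x i) - ∫ a, ψ a ∂P‖ ≤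
        M / √N * (2 + √(2 * Real.log (1 / δ))) := by
  have hNr : (0 : ℝ) < N := Nat.cast_pos.2 hN
  set π := Measure.pi fun _ : Fin N => P
  -- For `M = 0` the tail exponent below degenerates to 0/0, but then `ψ` vanishes identically.
  rcases hM0.eq_or_lt with rfl | hMpos
  · have : ∀ x, ψ x = 0 := fun x => norm_le_zero_iff.1 (hM x)
    exact ⟨Set.univ, MeasurableSet.univ, by simpa using hδ₀.le, by simp [this]⟩
  set μ := ∫ a, ψ a ∂P with hμ
  have hψi : Integrable ψ P := Integrable.of_bound (C := M) hψ.aestronglyMeasurable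
    (Filter.Eventually.of_forall hM)
  have hμM : ‖μ‖ ≤ M := by
    simpa using norm_integral_le_of_norm_le_const (μ := P) (Filter.Eventually.of_forall hM)
  let ξ : X → H := fun a => ψ a - μ
  have hξ : StronglyMeasurable ξ := hψ.sub stronglyMeasurable_const
  have hξM : ∀ a, ‖ξ a‖ ≤ 2 * M := fun a => (norm_sub_le _ _).trans (by linarith [hM a])
  have hξ0 : ∫ a, ξ a ∂P = 0 := by
    simp only [ξ]
    rw [integral_sub hψi (integrable_const _)]
    simp [hμ]
  let f : (Fin N → X) → ℝ := fun x => ‖∑ i, ξ (x i)‖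
  have hf : Measurable f := (stronglyMeasurable_sum_comp hξ).norm.measurable
  have hfM : ∀ x, |f x| ≤ N * (2 * M) := fun x => by
    rw [abs_of_nonneg (norm_nonneg _)]
    exact norm_sum_comp_le hξM x
  -- The centring cancels in a difference, which gives `2 * M` although `ξ` itself is only bounded
  -- by `2 * M`.
  have hfb : ∀ x i a, |f (Function.update x i a) - f x| ≤ 2 * M := fun x i a => by
    refine (abs_norm_sub_norm_le _ _).trans ?_
    rw [← Finset.sum_sub_distrib, Finset.sum_eq_single i]
    · have : ξ (Function.update x i a i) - ξ (x i) = ψ a - ψ (x i) := by simp [ξ]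
      rw [this]
      exact (norm_sub_le _ _).trans (by linarith [hM a, hM (x i)])
    · intro j _ hj
      simp [Function.update_of_ne hj]
    · simp
  -- Chosen so that the tail bound exp(-t²/(2NM²)) equals `δ`.
  set t := M * √(2 * N * Real.log (1 / δ)) with ht
  have hlog : 0 ≤ Real.log (1 / δ) := Real.log_nonneg (by rw [le_div_iff₀ hδ₀]; linarith)
  have htail := measure_ge_le_of_bounded_differences P hf hfM hfb (ε := t) (by positivity)
  have hexp : Real.exp (-t ^ 2 / (2 * (N * (2 * M / 2) ^ 2))) = δ := by
    rw [ht, mul_pow, Real.sq_sqrt (by positivity)]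
    have : -(M ^ 2 * (2 * N * Real.log (1 / δ))) / (2 * (N * (2 * M / 2) ^ 2)) = Real.log δ := by
      rw [one_div, Real.log_inv]
      field_simp
    rw [this, Real.exp_log hδ₀]
  rw [hexp] at htail
  -- The first moment is at most the root of the second; this is the source of the summand 2 in the
  -- final factor.
  have hmean : ∫ x, f x ∂π ≤ 2 * M * √N := by
    have hmem : MemLp f 2 π := MemLp.of_bound hf.aestronglyMeasurable _
      (Filter.Eventually.of_forall hfM)
    have h1 : (∫ x, f x ∂π) ^ 2 ≤ ∫ x, f x ^ 2 ∂π := by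
      have := ProbabilityTheory.variance_nonneg f π
      rw [ProbabilityTheory.variance_eq_sub hmem] at this
      simpa using this
    have h2 : ∫ x, f x ^ 2 ∂π ≤ N * (2 * M) ^ 2 := integral_norm_sum_sq_le P hξ hξM hξ0 N
    refine abs_le_of_sq_le_sq' ?_ (by positivity) |>.2
    refine h1.trans (h2.trans (le_of_eq ?_))
    rw [mul_pow, mul_pow (2 * M), Real.sq_sqrt hNr.le]
    ring
  have hE : MeasurableSet {x | t ≤ f x - ∫ x, f x ∂π} :=
    measurableSet_le measurable_const (hf.sub measurable_const)
  refine ⟨{x | t ≤ f x - ∫ x, f x ∂π}ᶜ, hE.compl, ?_, ?_⟩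
  · rw [probReal_compl_eq_one_sub hE]
    linarith
  · intro x hx
    simp only [Set.mem_compl_iff, Set.mem_ofPred_eq, not_le] at hx
    have h1 : (N : ℝ)⁻¹ • ∑ i, ψ (x i) - μ = (N : ℝ)⁻¹ • ∑ i, ξ (x i) := by
      simp only [ξ, Finset.sum_sub_distrib, smul_sub, Finset.sum_const, Finset.card_univ,
        Fintype.card_fin]
      rw [← Nat.cast_smul_eq_nsmul ℝ, smul_smul, inv_mul_cancel₀ hNr.ne', one_smul]
    rw [h1, norm_smul, norm_inv, Real.norm_of_nonneg hNr.le]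
    have h2 : f x ≤ M * √N * (2 + √(2 * Real.log (1 / δ))) := by
      have h3 : t = M * √N * √(2 * Real.log (1 / δ)) := by
        rw [ht, mul_assoc M, ← Real.sqrt_mul hNr.le]
        congr 2
        ring
      rw [mul_add, ← h3]
      linarith
    calc (N : ℝ)⁻¹ * ‖∑ i, ξ (x i)‖ ≤ (N : ℝ)⁻¹ * (M * √N * (2 + √(2 * Real.log (1 / δ)))) :=
          mul_le_mul_of_nonneg_left h2 (by positivity)
      _ = _ := by
          have : √(N : ℝ) ≠ 0 := (Real.sqrt_pos.2 hNr).ne'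
          rw [div_mul_eq_mul_div, eq_div_iff this]
          have h4 := Real.mul_self_sqrt hNr.le
          calc _ = (N : ℝ)⁻¹ * (√N * √N) * (M * (2 + √(2 * Real.log (1 / δ)))) := by ring
            _ = _ := by rw [h4, inv_mul_cancel₀ hNr.ne', one_mul]

/-- Concentration of the empirical mean of almost surely bounded random vectors. -/
theorem exists_norm_average_sub_integral_le [CompleteSpace H] (P : Measure X)
    [IsProbabilityMeasure P] {ψ : X → H} (hψ : StronglyMeasurable ψ) {M : ℝ} (hM0 : 0 ≤ M)
    (hM : ∀ᵐ x ∂P, ‖ψ x‖ ≤ M) {N : ℕ} (hN : 0 < N) {δ : ℝ} (hδ₀ : 0 < δ) (hδ₁ : δ < 1) :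
    ∃ E : Set (Fin N → X), MeasurableSet E ∧
      1 - δ ≤ (Measure.pi fun _ : Fin N => P).real E ∧
      ∀ x ∈ E, (∀ i, ‖ψ (x i)‖ ≤ M) ∧ ‖(N : ℝ)⁻¹ • ∑ i, ψ (x i) - ∫ a, ψ a ∂P‖ ≤
        M / √N * (2 + √(2 * Real.log (1 / δ))) := by
  -- Truncating `ψ` to `A` makes the bound hold everywhere without changing the integral; almost
  -- surely all samples lie in `A`.
  set A : Set X := {x | ‖ψ x‖ ≤ M} with hA
  have hAm : MeasurableSet A := measurableSet_le hψ.norm.measurable measurable_const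
  obtain ⟨E, hE, hPE, h⟩ := exists_norm_sum_le P (hψ.indicator hAm) hM0 (fun x => by
    by_cases hx : x ∈ A
    · rw [Set.indicator_of_mem hx]; exact hx
    · rw [Set.indicator_of_notMem hx]; simpa using hM0) hN hδ₀ hδ₁
  set B : Set (Fin N → X) := {x | ∀ i, x i ∈ A}
  have hB : MeasurableSet B := by
    have : B = ⋂ i, (fun x : Fin N → X => x i) ⁻¹' A := by ext; simp [B]
    rw [this]
    exact MeasurableSet.iInter fun i => measurable_pi_apply i hAm
  have hBae : B =ᵐ[Measure.pi fun _ : Fin N => P] Set.univ := by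
    rw [Filter.eventuallyEq_univ]
    exact Filter.eventually_all.2 fun i =>
      (Measure.quasiMeasurePreserving_eval (μ := fun _ : Fin N => P) i).ae hM
  refine ⟨E ∩ B, hE.inter hB, ?_, fun x hx => ⟨fun i => hx.2 i, ?_⟩⟩
  · refine hPE.trans (le_of_eq (measureReal_congr ?_))
    have := (Filter.EventuallyEq.refl _ E).inter hBae
    simpa using this.symm
  · have h1 := h x hx.1
    have h2 : ∫ a, A.indicator ψ a ∂P = ∫ a, ψ a ∂P :=
      integral_congr_ae (hM.mono fun a ha => Set.indicator_of_mem (s := A) ha ψ)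
    have h3 : ∀ i, A.indicator ψ (x i) = ψ (x i) := fun i => Set.indicator_of_mem (hx.2 i) ψ
    simpa only [h2, h3] using h1

end Concentration

/-! ### Covariance operators and their concentration. -/

section Covariance

variable {X H : Type*} [NormedAddCommGroup H] [InnerProductSpace ℝ H]

/-- The covariance operator `∫ φ(x) ⊗ φ(x) dP(x)` of a feature map. -/
noncomputable def covariance [MeasurableSpace X] (P : Measure X) (φ : X → H) : H →L[ℝ] H :=
  ∫ x, InnerProductSpace.rankOne ℝ (φ x) (φ x) ∂P

/-- The covariance operator of a feature map with respect to an empirical measure. -/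
noncomputable def empiricalCovariance {N : ℕ} (φ : X → H) (x : Fin N → X) : H →L[ℝ] H :=
  (N : ℝ)⁻¹ • ∑ i, InnerProductSpace.rankOne ℝ (φ (x i)) (φ (x i))

theorem empiricalCovariance_apply {N : ℕ} (φ : X → H) (x : Fin N → X) (v : H) :
    empiricalCovariance φ x v = (N : ℝ)⁻¹ • ∑ i, inner ℝ (φ (x i)) v • φ (x i) := by
  simp [empiricalCovariance]

theorem norm_le_of_inner_le {A : H →L[ℝ] H} {D : ℝ} (hD : 0 ≤ D)
    (h : ∀ u v, inner ℝ u (A v) ≤ D * (‖u‖ * ‖v‖)) : ‖A‖ ≤ D := by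
  refine A.opNorm_le_bound hD fun v => ?_
  have h1 := h (A v) v
  rw [real_inner_self_eq_norm_sq] at h1
  rcases (norm_nonneg (A v)).eq_or_lt with h0 | h0
  · rw [← h0]; positivity
  · nlinarith

variable [MeasurableSpace X]

theorem integrable_rankOne {P : Measure X} [IsProbabilityMeasure P] {φ : X → H}
    (hφ : StronglyMeasurable φ) {κ : ℝ} (hκ : ∀ᵐ x ∂P, ‖φ x‖ ^ 2 ≤ κ ^ 2) :
    Integrable (fun x => InnerProductSpace.rankOne ℝ (φ x) (φ x)) P := by
  have hc : Continuous fun v : H => InnerProductSpace.rankOne ℝ v v :=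
    (InnerProductSpace.rankOne (E := H) (F := H) ℝ).continuous₂.comp
      (continuous_id.prodMk continuous_id)
  refine Integrable.of_bound (C := κ ^ 2) (hc.comp_stronglyMeasurable hφ).aestronglyMeasurable
    (hκ.mono fun x hx => ?_)
  rw [InnerProductSpace.norm_rankOne, ← sq]
  exact hx

variable [CompleteSpace H]

theorem inner_covariance_apply {P : Measure X} [IsProbabilityMeasure P] {φ : X → H}
    (hφ : StronglyMeasurable φ) {κ : ℝ} (hκ : ∀ᵐ x ∂P, ‖φ x‖ ^ 2 ≤ κ ^ 2) (u v : H) :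
    inner ℝ u (covariance P φ v) = ∫ x, inner ℝ (φ x) u * inner ℝ (φ x) v ∂P := by
  have hi := integrable_rankOne hφ hκ
  have hi' : Integrable (fun x => InnerProductSpace.rankOne ℝ (φ x) (φ x) v) P :=
    hi.apply_continuousLinearMap v
  rw [covariance, ContinuousLinearMap.integral_apply hi, ← integral_inner hi']
  refine integral_congr_ae (Filter.Eventually.of_forall fun x => ?_)
  simp only [InnerProductSpace.rankOne_apply, inner_smul_right]
  rw [real_inner_comm u, mul_comm]

/-- Concentration of the empirical covariance operator. -/
theorem exists_norm_empiricalCovariance_sub_le (P : Measure X) [IsProbabilityMeasure P]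
    {φ : X → H} (hφ : StronglyMeasurable φ) {κ : ℝ} (hκ : ∀ᵐ x ∂P, ‖φ x‖ ^ 2 ≤ κ ^ 2)
    {N : ℕ} (hN : 0 < N) {δ : ℝ} (hδ₀ : 0 < δ) (hδ₁ : δ < 1) :
    ∃ E : Set (Fin N → X), MeasurableSet E ∧
      1 - δ ≤ (Measure.pi fun _ : Fin N => P).real E ∧
      ∀ x ∈ E, (∀ i, ‖φ (x i)‖ ^ 2 ≤ κ ^ 2) ∧ ‖empiricalCovariance φ x - covariance P φ‖ ≤
        κ ^ 2 / √N * (2 + √(2 * Real.log (1 / δ))) := by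
  -- The completed tensor square plays the role of the Hilbert–Schmidt operators: it supplies the
  -- inner product that the second moment bound needs, and its norm dominates the operator norm by
  -- pairing with `τ u v`.
  let τ : H → H → UniformSpace.Completion (TensorProduct ℝ H H) := fun u v =>
    ((TensorProduct.tmul ℝ u v : TensorProduct ℝ H H) : UniformSpace.Completion _)
  have hτ : ∀ a b u v, inner ℝ (τ a b) (τ u v) = inner ℝ a u * inner ℝ b v := fun a b u v => by
    simp [τ, UniformSpace.Completion.inner_coe]
  have hτn : ∀ u v, ‖τ u v‖ = ‖u‖ * ‖v‖ := fun u v => by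
    simp [τ, UniformSpace.Completion.norm_coe]
  have hτc : Continuous fun u : H => τ u u :=
    (UniformSpace.Completion.continuous_coe _).comp
      (TensorProduct.continuous_tmul.comp (continuous_id.prodMk continuous_id))
  have hψ : StronglyMeasurable fun x => τ (φ x) (φ x) := hτc.comp_stronglyMeasurable hφ
  have hψκ : ∀ᵐ x ∂P, ‖τ (φ x) (φ x)‖ ≤ κ ^ 2 := hκ.mono fun x hx => by
    rw [hτn, ← sq]; exact hx
  obtain ⟨E, hE, hPE, h⟩ :=
    exists_norm_average_sub_integral_le P hψ (sq_nonneg κ) hψκ hN hδ₀ hδ₁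
  have hψi : Integrable (fun x => τ (φ x) (φ x)) P :=
    Integrable.of_bound hψ.aestronglyMeasurable (κ ^ 2) hψκ
  refine ⟨E, hE, hPE, fun x hx => ⟨fun i => ?_, ?_⟩⟩
  · have := (h x hx).1 i
    rwa [hτn, ← sq] at this
  · refine le_trans (norm_le_of_inner_le (norm_nonneg _) fun u v => ?_) (h x hx).2
    have h1 : inner ℝ u ((empiricalCovariance φ x - covariance P φ) v) =
        inner ℝ ((N : ℝ)⁻¹ • ∑ i, τ (φ (x i)) (φ (x i)) - ∫ a, τ (φ a) (φ a) ∂P) (τ u v) := by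
      rw [_root_.sub_apply, inner_sub_right, inner_covariance_apply hφ hκ,
        inner_sub_left, empiricalCovariance_apply, inner_smul_right, inner_sum,
        real_inner_smul_left, sum_inner, real_inner_comm (τ u v) (∫ a, τ (φ a) (φ a) ∂P),
        ← integral_inner hψi]
      congr 1
      · congr 1
        refine Finset.sum_congr rfl fun i _ => ?_
        rw [hτ, inner_smul_right, real_inner_comm u, mul_comm]
      · refine integral_congr_ae (Filter.Eventually.of_forall fun a => ?_)
        simp only [hτ]
        rw [real_inner_comm u, real_inner_comm v]
    rw [h1, ← hτn]
    exact real_inner_le_norm _ _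

end Covariance

/-! ### The series s(t)/t at scalars and at operators. -/

section PowerSeries

/-- The series `∑_{p ≥ 0} c_{p+1} A^p`, which is `s(A) / A`. -/
noncomputable def quotientSeries {𝔸 : Type*} [NormedRing 𝔸] [NormedAlgebra ℝ 𝔸] (c : ℕ → ℝ)
    (A : 𝔸) : 𝔸 :=
  ∑' p : ℕ, c (p + 1) • A ^ p

/-- The termwise derivative of `∑_{p ≥ 0} c_{p+1} t^p`. -/
noncomputable def quotientSeriesDeriv (c : ℕ → ℝ) (t : ℝ) : ℝ :=
  ∑' p : ℕ, c (p + 1) * (p * t ^ (p - 1))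

variable {c : ℕ → ℝ} {L : ℝ}

theorem InsideConvergence.mono {t : ℝ} (h : InsideConvergence c L) (ht : t ≤ L) :
    InsideConvergence c t :=
  let ⟨r, hr, hs⟩ := h
  ⟨r, ht.trans_lt hr, hs⟩

theorem InsideConvergence.summable_deriv (hc : ∀ p, 0 ≤ c (p + 1)) (h : InsideConvergence c L)
    (hL : 0 ≤ L) : Summable fun p : ℕ => c (p + 1) * (p * L ^ (p - 1)) := by
  obtain ⟨r, hr, hs⟩ := h
  have hr0 : 0 < r := hL.trans_lt hr
  have hq : Summable fun p : ℕ => (p : ℝ) * (L / r) ^ (p - 1) := by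
    have h1 : ‖L / r‖ < 1 := by
      rw [Real.norm_of_nonneg (by positivity), div_lt_one hr0]
      exact hr
    rw [← summable_nat_add_iff 1]
    have h2 := (summable_pow_mul_geometric_of_norm_lt_one 1 h1).add
      (summable_pow_mul_geometric_of_norm_lt_one 0 h1)
    refine h2.congr fun p => ?_
    simp only [pow_one, pow_zero, add_tsub_cancel_right]
    push_cast
    ring
  obtain ⟨C, hC⟩ := hq.tendsto_atTop_zero.bddAbove_range
  refine Summable.of_nonneg_of_le (fun p => mul_nonneg (hc p) (by positivity)) (fun p => ?_)
    (hs.mul_right (C / r ^ 2))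
  have h3 : (p : ℝ) * (L / r) ^ (p - 1) ≤ C := hC ⟨p, rfl⟩
  rw [mul_assoc]
  refine mul_le_mul_of_nonneg_left ?_ (hc p)
  rcases p with _ | p
  · simp only [CharP.cast_eq_zero, zero_mul] at h3 ⊢
    positivity
  · simp only [add_tsub_cancel_right] at h3 ⊢
    rw [div_pow, mul_div_assoc', div_le_iff₀ (by positivity)] at h3
    calc _ ≤ C * r ^ p := h3
      _ = _ := by field_simp; ring

theorem InsideConvergence.summable (hc : ∀ p, 0 ≤ c (p + 1)) (h : InsideConvergence c L)
    (hL : 0 ≤ L) : Summable fun p : ℕ => c (p + 1) * L ^ p := by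
  obtain ⟨r, hr, hs⟩ := h
  have hr0 : 0 < r := hL.trans_lt hr
  refine Summable.of_nonneg_of_le (fun p => mul_nonneg (hc p) (by positivity)) (fun p => ?_)
    (hs.mul_right r⁻¹)
  rw [mul_assoc]
  refine mul_le_mul_of_nonneg_left ?_ (hc p)
  rw [pow_succ, mul_inv_cancel_right₀ hr0.ne']
  exact pow_le_pow_left₀ hL hr.le p

theorem transform_eq_mul_quotientSeries (c : ℕ → ℝ) (t : ℝ) :
    transform c t = t * quotientSeries c t := by
  rw [transform, quotientSeries, ← tsum_mul_left]
  refine tsum_congr fun p => ?_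
  rw [smul_eq_mul, pow_succ]
  ring

theorem quotientSeries_nonneg (hc : ∀ p, 0 ≤ c (p + 1)) {t : ℝ} (ht : 0 ≤ t) :
    0 ≤ quotientSeries c t :=
  tsum_nonneg fun p => mul_nonneg (hc p) (by positivity)

theorem quotientSeriesDeriv_nonneg (hc : ∀ p, 0 ≤ c (p + 1)) {t : ℝ} (ht : 0 ≤ t) :
    0 ≤ quotientSeriesDeriv c t :=
  tsum_nonneg fun p => mul_nonneg (hc p) (by positivity)

theorem quotientSeries_mono (hc : ∀ p, 0 ≤ c (p + 1)) (h : InsideConvergence c L) {t : ℝ}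
    (ht : 0 ≤ t) (htL : t ≤ L) : quotientSeries c t ≤ quotientSeries c L :=
  Summable.tsum_le_tsum
    (fun p => mul_le_mul_of_nonneg_left (pow_le_pow_left₀ ht htL p) (hc p))
    ((h.mono htL).summable hc ht) (h.summable hc (ht.trans htL))

theorem transform_mono (hc : ∀ p, 0 ≤ c (p + 1)) (h : InsideConvergence c L) {t : ℝ}
    (ht : 0 ≤ t) (htL : t ≤ L) : transform c t ≤ transform c L := by
  rw [transform_eq_mul_quotientSeries, transform_eq_mul_quotientSeries]
  exact mul_le_mul htL (quotientSeries_mono hc h ht htL) (quotientSeries_nonneg hc ht)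
    (ht.trans htL)

theorem deriv_transform_div (hc : ∀ p, 0 ≤ c (p + 1)) (h : InsideConvergence c L) (hL : 0 < L) :
    deriv (fun t => transform c t / t) L = quotientSeriesDeriv c L := by
  obtain ⟨r, hr, hs⟩ := h
  -- Termwise differentiation needs one summable bound near `L`; the derivative series at an
  -- intermediate `q` provides it on (0, q).
  obtain ⟨q, hLq, hqr⟩ := exists_between hr
  have hq0 : 0 < q := hL.trans hLq
  have hq : InsideConvergence c q := ⟨r, hqr, hs⟩
  have hder : HasDerivAt (fun t : ℝ => ∑' p : ℕ, c (p + 1) * t ^ p)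
      (∑' p : ℕ, c (p + 1) * (p * L ^ (p - 1))) L := by
    refine hasDerivAt_tsum_of_isPreconnected (hq.summable_deriv hc hq0.le) (t := Set.Ioo 0 q)
      (g' := fun (p : ℕ) t => c (p + 1) * (p * t ^ (p - 1))) isOpen_Ioo isPreconnected_Ioo
      (fun p t _ => (hasDerivAt_pow p t).const_mul _) (fun p t ht => ?_)
      (y₀ := L) ⟨hL, hLq⟩ ((hq.mono hLq.le).summable hc hL.le) ⟨hL, hLq⟩
    rw [Real.norm_of_nonneg (mul_nonneg (hc p)
      (mul_nonneg p.cast_nonneg (pow_nonneg ht.1.le _)))]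
    exact mul_le_mul_of_nonneg_left (mul_le_mul_of_nonneg_left
      (pow_le_pow_left₀ ht.1.le ht.2.le _) p.cast_nonneg) (hc p)
  have heq : (fun t => transform c t / t) =ᶠ[nhds L] fun t => ∑' p : ℕ, c (p + 1) * t ^ p := by
    filter_upwards [lt_mem_nhds hL] with t ht
    rw [transform_eq_mul_quotientSeries, mul_div_cancel_left₀ _ ht.ne']
    rfl
  rw [heq.deriv_eq, hder.deriv]
  rfl

variable {𝔸 : Type*} [NormedRing 𝔸] [NormOneClass 𝔸]

/-- Telescoping, which does not require `A` and `B` to commute. -/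
theorem norm_pow_sub_pow_le {A B : 𝔸} (hA : ‖A‖ ≤ L) (hB : ‖B‖ ≤ L) (p : ℕ) :
    ‖A ^ p - B ^ p‖ ≤ p * L ^ (p - 1) * ‖A - B‖ := by
  have hL : 0 ≤ L := (norm_nonneg _).trans hA
  induction p with
  | zero => simp
  | succ p ih =>
    have h1 : A ^ (p + 1) - B ^ (p + 1) = A ^ p * (A - B) + (A ^ p - B ^ p) * B := by
      rw [pow_succ, pow_succ]; noncomm_ring
    have h2 : ‖A ^ p‖ ≤ L ^ p := (norm_pow_le A p).trans (pow_le_pow_left₀ (norm_nonneg _) hA p)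
    have h3 : (p : ℝ) * L ^ (p - 1) * L = p * L ^ p := by
      rcases p with _ | p
      · simp
      · rw [add_tsub_cancel_right, pow_succ]; ring
    rw [h1]
    calc _ ≤ ‖A ^ p‖ * ‖A - B‖ + ‖A ^ p - B ^ p‖ * ‖B‖ :=
          (norm_add_le _ _).trans (add_le_add (norm_mul_le _ _) (norm_mul_le _ _))
      _ ≤ L ^ p * ‖A - B‖ + (p * L ^ (p - 1) * ‖A - B‖) * L := by gcongr
      _ = L ^ p * ‖A - B‖ + (p * L ^ (p - 1) * L) * ‖A - B‖ := by ring
      _ = _ := by rw [h3, add_tsub_cancel_right]; push_cast; ring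

variable [NormedAlgebra ℝ 𝔸]

theorem norm_smul_pow_le (hc : ∀ p, 0 ≤ c (p + 1)) {A : 𝔸} (hA : ‖A‖ ≤ L) (p : ℕ) :
    ‖c (p + 1) • A ^ p‖ ≤ c (p + 1) * L ^ p := by
  rw [norm_smul, Real.norm_of_nonneg (hc p)]
  exact mul_le_mul_of_nonneg_left ((norm_pow_le A p).trans
    (pow_le_pow_left₀ (norm_nonneg _) hA p)) (hc p)

theorem norm_quotientSeries_le (hc : ∀ p, 0 ≤ c (p + 1)) (h : InsideConvergence c L) {A : 𝔸}
    (hA : ‖A‖ ≤ L) : ‖quotientSeries c A‖ ≤ quotientSeries c L :=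
  tsum_of_norm_bounded (h.summable hc ((norm_nonneg _).trans hA)).hasSum (norm_smul_pow_le hc hA)

variable [CompleteSpace 𝔸]

theorem summable_smul_pow (hc : ∀ p, 0 ≤ c (p + 1)) (h : InsideConvergence c L) {A : 𝔸}
    (hA : ‖A‖ ≤ L) : Summable fun p : ℕ => c (p + 1) • A ^ p :=
  Summable.of_norm_bounded (h.summable hc ((norm_nonneg _).trans hA)) (norm_smul_pow_le hc hA)

theorem norm_quotientSeries_sub_le (hc : ∀ p, 0 ≤ c (p + 1)) (h : InsideConvergence c L)
    {A B : 𝔸} (hA : ‖A‖ ≤ L) (hB : ‖B‖ ≤ L) :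
    ‖quotientSeries c A - quotientSeries c B‖ ≤ quotientSeriesDeriv c L * ‖A - B‖ := by
  rw [quotientSeries, quotientSeries,
    ← (summable_smul_pow hc h hA).tsum_sub (summable_smul_pow hc h hB)]
  refine tsum_of_norm_bounded
    ((h.summable_deriv hc ((norm_nonneg _).trans hA)).hasSum.mul_right _) fun p => ?_
  rw [← smul_sub, norm_smul, Real.norm_of_nonneg (hc p), mul_assoc]
  exact mul_le_mul_of_nonneg_left (norm_pow_sub_pow_le hA hB p) (hc p)

end PowerSeries

/-! ### The ℓ² feature map and the diagonal operator T. -/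

section Feature

variable {X : Type*} [MeasurableSpace X] {P : Measure X} {k : X → X → ℝ} {lam : ℕ → ℝ}
  {e : ℕ → X → ℝ}

/-- The Hilbert space of square summable real sequences. -/
abbrev SeqSpace : Type := lp (fun _ : ℕ => ℝ) 2

/-- Nontriviality gives the identity operator norm 1, as the estimates on operator powers require.
-/
instance : Nontrivial SeqSpace :=
  ⟨lp.single 2 0 1, 0, fun h => by
    have := congrArg (fun f : SeqSpace => f 0) h
    simp at this⟩

theorem hasSum_mul_apply (u v : SeqSpace) : HasSum (fun i => u i * v i) (inner ℝ u v) := by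
  simpa [mul_comm] using lp.hasSum_inner (𝕜 := ℝ) u v

/-- The feature map `x ↦ (√λ_i e_i(x))_i` of a kernel with a spectral expansion. -/
noncomputable def feature (hk : IsSpectralExpansion P k lam e) (x : X) : SeqSpace :=
  ⟨fun i => √(lam i) * e i x, memℓp_gen (by
    refine (hk.hasSum x x).summable.congr fun i => ?_
    rw [ENNReal.toReal_ofNat, Real.rpow_two, Real.norm_eq_abs, sq_abs, mul_pow,
      Real.sq_sqrt (hk.nonneg i)]
    ring)⟩

theorem feature_apply (hk : IsSpectralExpansion P k lam e) (x : X) (i : ℕ) :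
    feature hk x i = √(lam i) * e i x := rfl

theorem inner_feature (hk : IsSpectralExpansion P k lam e) (x z : X) :
    inner ℝ (feature hk x) (feature hk z) = k x z := by
  refine (hasSum_mul_apply _ _).unique ?_
  convert hk.hasSum x z using 2 with i
  rw [feature_apply, feature_apply]
  linear_combination e i x * e i z * Real.mul_self_sqrt (hk.nonneg i)

theorem norm_feature_sq (hk : IsSpectralExpansion P k lam e) (x : X) :
    ‖feature hk x‖ ^ 2 = k x x := by
  rw [← real_inner_self_eq_norm_sq, inner_feature]

theorem stronglyMeasurable_feature (hk : IsSpectralExpansion P k lam e) :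
    StronglyMeasurable (feature hk) := by
  refine stronglyMeasurable_of_tendsto Filter.atTop
    (f := fun (N : ℕ) x => ∑ i ∈ Finset.range N, lp.single 2 i (feature hk x i)) (fun N => ?_) ?_
  · refine Finset.stronglyMeasurable_fun_sum _ fun i _ => ?_
    have h1 : Measurable fun x => feature hk x i := (hk.measurable i).const_mul _
    have h2 : ∀ x, (lp.single 2 i (feature hk x i) : SeqSpace) =
        feature hk x i • lp.single 2 i (1 : ℝ) := fun x => by
      rw [← lp.single_smul, smul_eq_mul, mul_one]
    simp_rw [h2]
    exact h1.stronglyMeasurable.smul_const _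
  · rw [tendsto_pi_nhds]
    intro x
    exact (lp.hasSum_single (by norm_num) (feature hk x)).tendsto_sum_nat

variable {κ : ℝ}

theorem ae_norm_feature_sq_le (hk : IsSpectralExpansion P k lam e)
    (hκ : ∀ᵐ x ∂P, k x x ≤ κ ^ 2) : ∀ᵐ x ∂P, ‖feature hk x‖ ^ 2 ≤ κ ^ 2 :=
  hκ.mono fun x hx => by rwa [norm_feature_sq]

variable [IsProbabilityMeasure P]

/-- The covariance operator of the feature map is diagonal. -/
theorem covariance_feature_apply (hk : IsSpectralExpansion P k lam e)
    (hκ : ∀ᵐ x ∂P, k x x ≤ κ ^ 2) (v : SeqSpace) (i : ℕ) :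
    covariance P (feature hk) v i = lam i * v i := by
  have hinner := inner_covariance_apply (stronglyMeasurable_feature hk)
    (ae_norm_feature_sq_le hk hκ)
  have hcoord : ∀ (w : SeqSpace) j, inner ℝ (lp.single 2 j (1 : ℝ)) w = w j := fun w j => by
    rw [lp.inner_single_left]
    simp
  have hcoord' : ∀ (w : SeqSpace) j, inner ℝ w (lp.single 2 j (1 : ℝ)) = w j := fun w j => by
    rw [real_inner_comm, hcoord]
  have hsingle : covariance P (feature hk) (lp.single 2 i (1 : ℝ)) = lam i • lp.single 2 i 1 := by
    ext j
    rw [← hcoord, hinner]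
    simp only [hcoord', feature_apply]
    have h1 : ∀ x, √(lam j) * e j x * (√(lam i) * e i x) =
        √(lam j) * √(lam i) * (e j x * e i x) := fun x => by ring
    simp_rw [h1]
    rw [integral_const_mul]
    -- Orthonormality is available only for nonzero eigenvalues; where one vanishes, the factor √λ
    -- kills the entry.
    by_cases hi : lam i = 0
    · simp [hi]
    by_cases hj : lam j = 0
    · have : j ≠ i := by rintro rfl; exact hi hj
      simp [hj, Pi.single_eq_of_ne this]
    rw [hk.orthonormal j i hj hi]
    by_cases hij : j = i
    · subst hij
      simp [Real.mul_self_sqrt (hk.nonneg j)]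
    · simp [hij]
  have hsymm : ∀ u w, inner ℝ u (covariance P (feature hk) w) =
      inner ℝ (covariance P (feature hk) u) w := fun u w => by
    rw [real_inner_comm w, hinner, hinner]
    simp_rw [mul_comm]
  rw [← hcoord, hsymm, hsingle, real_inner_smul_left, hcoord]

theorem norm_covariance_feature_le (hk : IsSpectralExpansion P k lam e)
    (hκ : ∀ᵐ x ∂P, k x x ≤ κ ^ 2) : ‖covariance P (feature hk)‖ ≤ lam 0 := by
  refine norm_le_of_inner_le (hk.nonneg 0) fun u v => ?_
  refine (real_inner_le_norm _ _).trans ?_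
  rw [mul_left_comm]
  refine mul_le_mul_of_nonneg_left ?_ (norm_nonneg _)
  refine abs_le_of_sq_le_sq' ?_ (mul_nonneg (hk.nonneg 0) (norm_nonneg _)) |>.2
  rw [mul_pow, ← real_inner_self_eq_norm_sq, ← real_inner_self_eq_norm_sq]
  refine hasSum_le (fun i => ?_) (hasSum_mul_apply _ _)
    ((hasSum_mul_apply v v).mul_left (lam 0 ^ 2))
  rw [covariance_feature_apply hk hκ]
  have h1 : lam i ^ 2 ≤ lam 0 ^ 2 :=
    pow_le_pow_left₀ (hk.nonneg i) (hk.antitone (Nat.zero_le i)) 2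
  nlinarith [sq_nonneg (v i)]

variable {c : ℕ → ℝ}

/-- A power of a diagonal operator is diagonal, and evaluating at `v` and taking a coordinate are
continuous, hence commute with the series. -/
theorem quotientSeries_covariance_apply (hk : IsSpectralExpansion P k lam e)
    (hκ : ∀ᵐ x ∂P, k x x ≤ κ ^ 2) (hc : ∀ p, 0 ≤ c (p + 1)) (h : InsideConvergence c (lam 0))
    (v : SeqSpace) (i : ℕ) :
    quotientSeries c (covariance P (feature hk)) v i = quotientSeries c (lam i) * v i := by
  have hpow : ∀ (p : ℕ) v, (covariance P (feature hk) ^ p) v i = lam i ^ p * v i := by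
    intro p
    induction p with
    | zero => simp
    | succ p ih =>
      intro v
      rw [pow_succ, mul_apply_eq_comp, ih, covariance_feature_apply hk hκ]
      ring
  have hs := (summable_smul_pow hc h (norm_covariance_feature_le hk hκ)).hasSum
  have h1 := hs.mapL (ContinuousLinearMap.apply ℝ SeqSpace v)
  have h2 := h1.mapL (innerSL ℝ (lp.single 2 i (1 : ℝ) : SeqSpace))
  have hcoord : ∀ w : SeqSpace, innerSL ℝ (lp.single 2 i (1 : ℝ) : SeqSpace) w = w i := fun w => by
    rw [innerSL_apply_apply, lp.inner_single_left]
    simp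
  simp only [hcoord] at h2
  refine h2.unique ?_
  have h3 : InsideConvergence c (lam i) := h.mono (hk.antitone (Nat.zero_le i))
  have h4 : HasSum (fun p => c (p + 1) * lam i ^ p * v i) (quotientSeries c (lam i) * v i) :=
    (h3.summable hc (hk.nonneg i)).hasSum.mul_right (v i)
  have h5 : (fun p => c (p + 1) * lam i ^ p * v i) = fun p =>
      (ContinuousLinearMap.apply ℝ SeqSpace v (c (p + 1) • covariance P (feature hk) ^ p)) i := by
    funext p
    rw [ContinuousLinearMap.apply_apply, _root_.smul_apply, lp.coeFn_smul, Pi.smul_apply, hpow,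
      smul_eq_mul, mul_assoc]
  exact h5 ▸ h4

/-- The transformed kernel is the kernel of the feature map twisted by `s(T) / T`. -/
theorem stk_eq_inner (hk : IsSpectralExpansion P k lam e)
    (hκ : ∀ᵐ x ∂P, k x x ≤ κ ^ 2) (hc : ∀ p, 0 ≤ c (p + 1)) (h : InsideConvergence c (lam 0))
    (x z : X) :
    stk (transform c) lam e x z = inner ℝ (feature hk x)
      (quotientSeries c (covariance P (feature hk)) (feature hk z)) := by
  rw [stk, ← (hasSum_mul_apply _ _).tsum_eq]
  refine tsum_congr fun i => ?_
  rw [quotientSeries_covariance_apply hk hκ hc h, feature_apply, feature_apply,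
    transform_eq_mul_quotientSeries]
  linear_combination -(quotientSeries c (lam i) * e i x * e i z) * Real.mul_self_sqrt (hk.nonneg i)

/-- The quadratic form of `T` is the squared `L²(P)` norm. -/
theorem integral_inner_feature_sq (hk : IsSpectralExpansion P k lam e)
    (hκ : ∀ᵐ x ∂P, k x x ≤ κ ^ 2) (w : SeqSpace) :
    ∫ x, inner ℝ (feature hk x) w ^ 2 ∂P = inner ℝ w (covariance P (feature hk) w) := by
  rw [inner_covariance_apply (stronglyMeasurable_feature hk) (ae_norm_feature_sq_le hk hκ)]
  simp_rw [sq]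

theorem memLp_inner_feature (hk : IsSpectralExpansion P k lam e)
    (hκ : ∀ᵐ x ∂P, k x x ≤ κ ^ 2) (w : SeqSpace) :
    MemLp (fun x => inner ℝ (feature hk x) w) 2 P := by
  refine MemLp.of_bound (C := |κ| * ‖w‖)
    ((stronglyMeasurable_feature hk).inner stronglyMeasurable_const).aestronglyMeasurable
    ((ae_norm_feature_sq_le hk hκ).mono fun x hx => ?_)
  refine (norm_inner_le_norm _ _).trans (mul_le_mul_of_nonneg_right ?_ (norm_nonneg _))
  simpa using sq_le_sq.1 hx

/-- `g(T) T g(T) ≤ s(λ₁) g(T)` for `g(t) = s(t) / t`, as quadratic forms. -/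
theorem inner_covariance_quotientSeries_le (hk : IsSpectralExpansion P k lam e)
    (hκ : ∀ᵐ x ∂P, k x x ≤ κ ^ 2) (hc : ∀ p, 0 ≤ c (p + 1)) (h : InsideConvergence c (lam 0))
    (q : SeqSpace) :
    inner ℝ (quotientSeries c (covariance P (feature hk)) q)
        (covariance P (feature hk) (quotientSeries c (covariance P (feature hk)) q)) ≤
      transform c (lam 0) * inner ℝ q (quotientSeries c (covariance P (feature hk)) q) := by
  refine hasSum_le (fun i => ?_) (hasSum_mul_apply _ _) ((hasSum_mul_apply _ _).mul_left _)
  rw [covariance_feature_apply hk hκ, quotientSeries_covariance_apply hk hκ hc h]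
  have h1 := transform_mono hc h (hk.nonneg i) (hk.antitone (Nat.zero_le i))
  have h2 := quotientSeries_nonneg hc (hk.nonneg i)
  calc _ = transform c (lam i) * (quotientSeries c (lam i) * q i ^ 2) := by
        rw [transform_eq_mul_quotientSeries]; ring
    _ ≤ transform c (lam 0) * (quotientSeries c (lam i) * q i ^ 2) := by gcongr
    _ = _ := by ring

theorem inner_quotientSeries_covariance_nonneg (hk : IsSpectralExpansion P k lam e)
    (hκ : ∀ᵐ x ∂P, k x x ≤ κ ^ 2) (hc : ∀ p, 0 ≤ c (p + 1)) (h : InsideConvergence c (lam 0))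
    (q : SeqSpace) :
    0 ≤ inner ℝ q (quotientSeries c (covariance P (feature hk)) q) := by
  refine (hasSum_mul_apply _ _).nonneg fun i => ?_
  rw [quotientSeries_covariance_apply hk hκ hc h]
  have h2 := quotientSeries_nonneg hc (hk.nonneg i)
  nlinarith [mul_nonneg h2 (sq_nonneg (q i))]

end Feature

/-! ### The largest eigenvalue and the Rayleigh quotient. -/

section LargestEigenvalue

theorem le_largestEigenvalue {N : ℕ} {A : Matrix (Fin N) (Fin N) ℝ} {t : ℝ}
    (h : Module.End.HasEigenvalue (Matrix.toLin' A) t) : t ≤ largestEigenvalue A :=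
  le_csSup (Module.End.finite_hasEigenvalue _).bddAbove h

/-- The Rayleigh quotient is bounded by the largest eigenvalue. -/
theorem dotProduct_mulVec_le_largestEigenvalue {N : ℕ} {A : Matrix (Fin N) (Fin N) ℝ}
    (hA : A.IsHermitian) (b : Fin N → ℝ) :
    b ⬝ᵥ (A *ᵥ b) ≤ largestEigenvalue A * (b ⬝ᵥ b) := by
  set l := largestEigenvalue A
  have hB : (l • (1 : Matrix (Fin N) (Fin N) ℝ) - A).IsHermitian := by
    refine Matrix.IsHermitian.sub ?_ hA
    simp [Matrix.IsHermitian]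
  have hpos : (l • (1 : Matrix (Fin N) (Fin N) ℝ) - A).PosSemidef := by
    rw [hB.posSemidef_iff_eigenvalues_nonneg]
    intro i
    have h1 := hB.mulVec_eigenvectorBasis i
    rw [Matrix.sub_mulVec, Matrix.smul_mulVec, Matrix.one_mulVec] at h1
    -- An eigenvalue μ of l - A gives the eigenvalue l - μ of A, which is at most l, so μ ≥ 0.
    have h2 : Module.End.HasEigenvalue (Matrix.toLin' A) (l - hB.eigenvalues i) := by
      refine Module.End.hasEigenvalue_of_hasEigenvector (x := ⇑(hB.eigenvectorBasis i))
        ⟨Module.End.mem_eigenspace_iff.2 ?_, fun h0 => ?_⟩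
      · rw [Matrix.toLin'_apply, sub_smul, ← h1]
        abel
      · refine hB.eigenvectorBasis.orthonormal.ne_zero i ?_
        ext j
        exact congrFun h0 j
    have := le_largestEigenvalue h2
    simp only [Pi.zero_apply]
    linarith
  have h := hpos.dotProduct_mulVec_nonneg b
  rw [Matrix.sub_mulVec, Matrix.smul_mulVec, Matrix.one_mulVec, dotProduct_sub,
    dotProduct_smul, smul_eq_mul, star_trivial] at h
  linarith

end LargestEigenvalue

/-! ### The empirical covariance operator and the Gram matrix. -/

section Empirical

variable {X H : Type*} [NormedAddCommGroup H] [InnerProductSpace ℝ H] {φ : X → H}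
  {k : X → X → ℝ} {N : ℕ}

theorem norm_sum_smul_sq (hφ : ∀ x z, inner ℝ (φ x) (φ z) = k x z) (x : Fin N → X)
    (b : Fin N → ℝ) : ‖∑ i, b i • φ (x i)‖ ^ 2 = b ⬝ᵥ (gram k x *ᵥ b) := by
  rw [← real_inner_self_eq_norm_sq, sum_inner, dotProduct]
  refine Finset.sum_congr rfl fun i _ => ?_
  rw [real_inner_smul_left, inner_sum, mulVec, dotProduct]
  congr 1
  refine Finset.sum_congr rfl fun j _ => ?_
  rw [real_inner_smul_right, hφ, mul_comm]
  rfl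

theorem norm_sum_smul_sq_le (hφ : ∀ x z, inner ℝ (φ x) (φ z) = k x z) (hN : 0 < N)
    (x : Fin N → X) (b : Fin N → ℝ) :
    ‖∑ i, b i • φ (x i)‖ ^ 2 ≤ N * largestEigenvalue ((N : ℝ)⁻¹ • gram k x) * ∑ i, b i ^ 2 := by
  have hNr : (0 : ℝ) < N := Nat.cast_pos.2 hN
  have hH : ((N : ℝ)⁻¹ • gram k x).IsHermitian := by
    ext i j
    simp [gram, ← hφ, real_inner_comm]
  have h := dotProduct_mulVec_le_largestEigenvalue hH b
  rw [Matrix.smul_mulVec, dotProduct_smul, smul_eq_mul, ← norm_sum_smul_sq hφ x b,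
    inv_mul_le_iff₀ hNr] at h
  refine h.trans (le_of_eq ?_)
  rw [mul_assoc, dotProduct]
  simp_rw [sq]

theorem largestEigenvalue_gram_nonneg (hφ : ∀ x z, inner ℝ (φ x) (φ z) = k x z) (hN : 0 < N)
    (x : Fin N → X) : 0 ≤ largestEigenvalue ((N : ℝ)⁻¹ • gram k x) := by
  have hNr : (0 : ℝ) < N := Nat.cast_pos.2 hN
  have h := (sq_nonneg _).trans (norm_sum_smul_sq_le hφ hN x 1)
  simp only [Pi.one_apply, one_pow, Finset.sum_const, Finset.card_univ, Fintype.card_fin,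
    nsmul_eq_mul, mul_one] at h
  have h1 : 0 ≤ largestEigenvalue ((N : ℝ)⁻¹ • gram k x) * (N * N) := by linarith
  exact nonneg_of_mul_nonneg_left h1 (by positivity)

/-- The adjoint of b ↦ ∑ b_i φ(x_i) obeys the same norm bound: the sum S equals ⟨w, u⟩ with ‖w‖² ≤
NlS, and one factor S cancels from S² ≤ ‖w‖²‖u‖². -/
theorem sum_inner_sq_le (hφ : ∀ x z, inner ℝ (φ x) (φ z) = k x z) (hN : 0 < N)
    (x : Fin N → X) (u : H) :
    ∑ i, inner ℝ (φ (x i)) u ^ 2 ≤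
      N * largestEigenvalue ((N : ℝ)⁻¹ • gram k x) * ‖u‖ ^ 2 := by
  set l := largestEigenvalue ((N : ℝ)⁻¹ • gram k x)
  have hl : 0 ≤ l := largestEigenvalue_gram_nonneg hφ hN x
  set S := ∑ i, inner ℝ (φ (x i)) u ^ 2
  have hS : 0 ≤ S := Finset.sum_nonneg fun i _ => sq_nonneg _
  set w := ∑ i, inner ℝ (φ (x i)) u • φ (x i)
  have h1 : S = inner ℝ w u := by
    rw [sum_inner]
    refine Finset.sum_congr rfl fun i _ => ?_
    rw [real_inner_smul_left, sq]
  have h2 : ‖w‖ ^ 2 ≤ N * l * S := norm_sum_smul_sq_le hφ hN x _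
  have h3 : S ≤ ‖w‖ * ‖u‖ := h1 ▸ real_inner_le_norm _ _
  rcases hS.eq_or_lt with h0 | h0
  · rw [← h0]; positivity
  · have h4 : S * S ≤ (N * l * ‖u‖ ^ 2) * S := by
      calc S * S ≤ (‖w‖ * ‖u‖) * (‖w‖ * ‖u‖) := mul_le_mul h3 h3 hS (by positivity)
        _ = ‖w‖ ^ 2 * ‖u‖ ^ 2 := by ring
        _ ≤ (N * l * S) * ‖u‖ ^ 2 := mul_le_mul_of_nonneg_right h2 (by positivity)
        _ = _ := by ring
    exact le_of_mul_le_mul_right h4 h0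

theorem inner_empiricalCovariance (x : Fin N → X) (u v : H) :
    inner ℝ u (empiricalCovariance φ x v) =
      (N : ℝ)⁻¹ * ∑ i, inner ℝ (φ (x i)) u * inner ℝ (φ (x i)) v := by
  rw [empiricalCovariance_apply, real_inner_smul_right, inner_sum]
  congr 1
  refine Finset.sum_congr rfl fun i _ => ?_
  rw [real_inner_smul_right, real_inner_comm u, mul_comm]

theorem norm_empiricalCovariance_le (hφ : ∀ x z, inner ℝ (φ x) (φ z) = k x z) (hN : 0 < N)
    (x : Fin N → X) :
    ‖empiricalCovariance φ x‖ ≤ largestEigenvalue ((N : ℝ)⁻¹ • gram k x) := by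
  have hNr : (0 : ℝ) < N := Nat.cast_pos.2 hN
  set l := largestEigenvalue ((N : ℝ)⁻¹ • gram k x)
  have hl : 0 ≤ l := largestEigenvalue_gram_nonneg hφ hN x
  refine norm_le_of_inner_le hl fun u v => ?_
  rw [inner_empiricalCovariance, inv_mul_le_iff₀ hNr]
  refine abs_le_of_sq_le_sq' ?_ (by positivity) |>.2
  refine (Finset.sum_mul_sq_le_sq_mul_sq _ _ _).trans ?_
  calc _ ≤ (N * l * ‖u‖ ^ 2) * (N * l * ‖v‖ ^ 2) :=
        mul_le_mul (sum_inner_sq_le hφ hN x u) (sum_inner_sq_le hφ hN x v)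
          (Finset.sum_nonneg fun i _ => sq_nonneg _) (by positivity)
    _ = _ := by ring

/-- The first application sends φ(w) into the span of the φ(x_i) with coefficients v_k(w)/N; every
later one multiplies the coefficients by G_k/N. Hence the Gram exponent is one lower. -/
theorem empiricalCovariance_pow_apply (hφ : ∀ x z, inner ℝ (φ x) (φ z) = k x z)
    (x : Fin N → X) (w : X) (p : ℕ) :
    (empiricalCovariance φ x ^ (p + 1)) (φ w) =
      ((N : ℝ) ^ (p + 1))⁻¹ • ∑ i, (gram k x ^ p *ᵥ kvec k x w) i • φ (x i) := by
  induction p with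
  | zero =>
    simp only [zero_add, pow_one, pow_zero, one_mulVec, empiricalCovariance_apply]
    congr 1
    refine Finset.sum_congr rfl fun i _ => ?_
    rw [real_inner_comm, hφ, kvec]
  | succ p ih =>
    rw [pow_succ', mul_apply_eq_comp, ih, map_smul, empiricalCovariance_apply, smul_smul,
      pow_succ' (N : ℝ) (p + 1), mul_inv, mul_comm (N : ℝ)⁻¹]
    congr 1
    refine Finset.sum_congr rfl fun i _ => ?_
    congr 1
    rw [pow_succ' (gram k x), ← mulVec_mulVec, inner_sum, mulVec, dotProduct]
    refine Finset.sum_congr rfl fun j _ => ?_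
    rw [real_inner_smul_right, hφ, mul_comm]
    rfl

theorem empiricalPower_eq_inner (hφ : ∀ x z, inner ℝ (φ x) (φ z) = k x z)
    (x : Fin N → X) (p : ℕ) (u w : X) :
    empiricalPower k x (p + 1) u w = inner ℝ (φ u) ((empiricalCovariance φ x ^ p) (φ w)) := by
  rcases p with _ | p
  · simp [empiricalPower, hφ]
  · rw [empiricalCovariance_pow_apply hφ, real_inner_smul_right, inner_sum]
    simp only [empiricalPower, real_inner_smul_right, hφ]
    rw [div_eq_inv_mul, dotProduct]
    simp_rw [mul_comm (kvec k x u _)]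
    rfl

variable [CompleteSpace H] [Nontrivial H] {c : ℕ → ℝ} {L : ℝ}

theorem hasSum_inner_quotientSeries (hc : ∀ p, 0 ≤ c (p + 1)) (h : InsideConvergence c L)
    {A : H →L[ℝ] H} (hA : ‖A‖ ≤ L) (u w : H) :
    HasSum (fun p => c (p + 1) * inner ℝ u ((A ^ p) w)) (inner ℝ u (quotientSeries c A w)) := by
  have h1 := ((summable_smul_pow hc h hA).hasSum.mapL (ContinuousLinearMap.apply ℝ H w)).mapL
    (innerSL ℝ u)
  simp only [ContinuousLinearMap.apply_apply, innerSL_apply_apply, _root_.smul_apply,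
    real_inner_smul_right] at h1
  exact h1

/-- The estimated kernel is the kernel of the feature map twisted by `s(T̂) / T̂`. -/
theorem empiricalStk_eq_inner (hφ : ∀ x z, inner ℝ (φ x) (φ z) = k x z)
    (hc : ∀ p, 0 ≤ c (p + 1)) (h : InsideConvergence c L) {x : Fin N → X}
    (hx : ‖empiricalCovariance φ x‖ ≤ L) (u w : X) :
    empiricalStk c k x u w =
      inner ℝ (φ u) (quotientSeries c (empiricalCovariance φ x) (φ w)) := by
  rw [← (hasSum_inner_quotientSeries hc h hx _ _).tsum_eq, empiricalStk]
  exact tsum_congr fun p => by rw [empiricalPower_eq_inner hφ]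

/-- By symmetry ⟨u, A^(p+2) u⟩ = ⟨Au, A^p (Au)⟩, so the exponent drops by two down to 0 or 1. -/
theorem inner_pow_nonneg {H : Type*} [NormedAddCommGroup H] [InnerProductSpace ℝ H]
    {A : H →L[ℝ] H} (hs : ∀ u v, inner ℝ u (A v) = inner ℝ (A u) v)
    (hp : ∀ u, 0 ≤ inner ℝ u (A u)) (p : ℕ) (u : H) : 0 ≤ inner ℝ u ((A ^ p) u) := by
  induction p using Nat.twoStepInduction generalizing u with
  | zero => simp
  | one => simpa using hp u
  | more p ih _ =>
    rw [pow_succ, pow_succ', mul_apply_eq_comp, mul_apply_eq_comp, hs]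
    exact ih (A u)

theorem inner_quotientSeries_empiricalCovariance_nonneg (hc : ∀ p, 0 ≤ c (p + 1))
    (h : InsideConvergence c L) {x : Fin N → X} (hx : ‖empiricalCovariance φ x‖ ≤ L) (q : H) :
    0 ≤ inner ℝ q (quotientSeries c (empiricalCovariance φ x) q) := by
  refine (hasSum_inner_quotientSeries hc h hx _ _).nonneg fun p =>
    mul_nonneg (hc p) (inner_pow_nonneg (fun u v => ?_) (fun u => ?_) p q)
  · rw [real_inner_comm v, inner_empiricalCovariance, inner_empiricalCovariance]
    simp_rw [mul_comm]
  · rw [inner_empiricalCovariance]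
    exact mul_nonneg (by positivity) (Finset.sum_nonneg fun i _ => mul_self_nonneg _)

end Empirical

/-! ### Ridge regression systems and their stability. -/

section Ridge

variable {n : ℕ} {ρ : ℝ}

/-- Nonnegativity of the form of `G` makes G + ρI injective, so the matrix inverse is a genuine one
and not the default value 0. -/
theorem ridge_solution {G : Matrix (Fin n) (Fin n) ℝ} (hG : ∀ a, 0 ≤ a ⬝ᵥ (G *ᵥ a)) (hρ : 0 < ρ)
    (y : Fin n → ℝ) :
    G *ᵥ ((G + ρ • (1 : Matrix (Fin n) (Fin n) ℝ))⁻¹ *ᵥ y) +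
      ρ • ((G + ρ • (1 : Matrix (Fin n) (Fin n) ℝ))⁻¹ *ᵥ y) = y := by
  set M := G + ρ • (1 : Matrix (Fin n) (Fin n) ℝ)
  have hM : ∀ a, M *ᵥ a = G *ᵥ a + ρ • a := fun a => by
    rw [add_mulVec, smul_mulVec, one_mulVec]
  have hinj : Function.Injective M.mulVec := by
    intro a b hab
    have h0 : M *ᵥ (a - b) = 0 := by
      rw [mulVec_sub]; exact sub_eq_zero.2 hab
    have h1 := congrArg (fun z => (a - b) ⬝ᵥ z) h0
    simp only [hM, dotProduct_add, dotProduct_smul, smul_eq_mul, dotProduct_zero] at h1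
    have h2 := hG (a - b)
    have h3 : (a - b) ⬝ᵥ (a - b) = 0 := by
      have h4 : 0 ≤ (a - b) ⬝ᵥ (a - b) := Finset.sum_nonneg fun i _ => mul_self_nonneg _
      nlinarith
    exact sub_eq_zero.1 (dotProduct_self_eq_zero.1 h3)
  have hu : IsUnit M := Matrix.mulVec_injective_iff_isUnit.1 hinj
  rw [← hM, mulVec_mulVec, Matrix.mul_nonsing_inv _ ((Matrix.isUnit_iff_isUnit_det _).1 hu),
    one_mulVec]

theorem ridge_norm_le {G : Matrix (Fin n) (Fin n) ℝ} (hG : ∀ a, 0 ≤ a ⬝ᵥ (G *ᵥ a)) (hρ : 0 < ρ)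
    {u y : Fin n → ℝ} (hu : G *ᵥ u + ρ • u = y) : ρ ^ 2 * ∑ i, u i ^ 2 ≤ ∑ i, y i ^ 2 := by
  set U := ∑ i, u i ^ 2
  have hU : 0 ≤ U := Finset.sum_nonneg fun i _ => sq_nonneg _
  have h1 : ρ * U ≤ ∑ i, u i * y i := by
    have h2 : u ⬝ᵥ y = u ⬝ᵥ (G *ᵥ u) + ρ * U := by
      rw [← hu, dotProduct_add, dotProduct_smul, smul_eq_mul]
      congr 2
      exact Finset.sum_congr rfl fun i _ => (sq _).symm
    have := hG u
    change ρ * U ≤ u ⬝ᵥ y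
    linarith
  have h3 := Finset.sum_mul_sq_le_sq_mul_sq Finset.univ u y
  rcases hU.eq_or_lt with h0 | h0
  · rw [← h0, mul_zero]
    exact Finset.sum_nonneg fun i _ => sq_nonneg _
  · have h4 : (ρ * U) ^ 2 ≤ U * ∑ i, y i ^ 2 :=
      (pow_le_pow_left₀ (by positivity) h1 2).trans h3
    nlinarith

variable {X H : Type*} [NormedAddCommGroup H] [InnerProductSpace ℝ H] {φ : X → H}

theorem dotProduct_gram_mulVec {K : X → X → ℝ} {S : H →L[ℝ] H}
    (hK : ∀ x z, K x z = inner ℝ (φ x) (S (φ z))) (x : Fin n → X) (a b : Fin n → ℝ) :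
    a ⬝ᵥ (gram K x *ᵥ b) = inner ℝ (∑ i, a i • φ (x i)) (S (∑ i, b i • φ (x i))) := by
  rw [sum_inner, dotProduct]
  refine Finset.sum_congr rfl fun i _ => ?_
  rw [real_inner_smul_left, map_sum, inner_sum, mulVec, dotProduct]
  congr 1
  refine Finset.sum_congr rfl fun j _ => ?_
  rw [map_smul, real_inner_smul_right, ← hK, mul_comm]
  rfl

theorem kvec_dotProduct {K : X → X → ℝ} {S : H →L[ℝ] H}
    (hK : ∀ x z, K x z = inner ℝ (φ x) (S (φ z))) (x : Fin n → X) (z : X) (b : Fin n → ℝ) :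
    kvec K x z ⬝ᵥ b = inner ℝ (φ z) (S (∑ i, b i • φ (x i))) := by
  rw [map_sum, inner_sum, dotProduct]
  refine Finset.sum_congr rfl fun i _ => ?_
  rw [map_smul, real_inner_smul_right, ← hK, mul_comm]
  rfl

theorem norm_sum_smul_sq_le_of_norm_le {κ : ℝ} {x : Fin n → X}
    (hx : ∀ i, ‖φ (x i)‖ ^ 2 ≤ κ ^ 2) (a : Fin n → ℝ) :
    ‖∑ i, a i • φ (x i)‖ ^ 2 ≤ n * κ ^ 2 * ∑ i, a i ^ 2 := by
  have h1 : ‖∑ i, a i • φ (x i)‖ ≤ ∑ i, |a i| * ‖φ (x i)‖ :=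
    (norm_sum_le _ _).trans (le_of_eq (Finset.sum_congr rfl fun i _ => by
      rw [norm_smul, Real.norm_eq_abs]))
  calc _ ≤ (∑ i, |a i| * ‖φ (x i)‖) ^ 2 := pow_le_pow_left₀ (norm_nonneg _) h1 2
    _ ≤ (∑ i, |a i| ^ 2) * ∑ i, ‖φ (x i)‖ ^ 2 := Finset.sum_mul_sq_le_sq_mul_sq _ _ _
    _ ≤ (∑ i, a i ^ 2) * (n * κ ^ 2) := by
        simp_rw [sq_abs]
        refine mul_le_mul_of_nonneg_left ?_ (Finset.sum_nonneg fun i _ => sq_nonneg _)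
        simpa using Finset.sum_le_sum fun i (_ : i ∈ Finset.univ) => hx i
    _ = _ := by ring

/-- Stability of kernel ridge regression coefficients under a perturbation of the kernel. -/
theorem ridge_perturbation {K K' : X → X → ℝ} {S S' : H →L[ℝ] H}
    (hK : ∀ x z, K x z = inner ℝ (φ x) (S (φ z))) (hK' : ∀ x z, K' x z = inner ℝ (φ x) (S' (φ z)))
    (hS : ∀ q, 0 ≤ inner ℝ q (S q)) (hS' : ∀ q, 0 ≤ inner ℝ q (S' q)) (hρ : 0 < ρ)
    {κ : ℝ} {x : Fin n → X} (hx : ∀ i, ‖φ (x i)‖ ^ 2 ≤ κ ^ 2) {u v y : Fin n → ℝ}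
    (hu : gram K' x *ᵥ u + ρ • u = y) (hv : gram K x *ᵥ v + ρ • v = y) :
    ‖∑ i, u i • φ (x i)‖ ^ 2 ≤ n * κ ^ 2 * (∑ i, y i ^ 2) / ρ ^ 2 ∧
    inner ℝ (∑ i, (u - v) i • φ (x i)) (S (∑ i, (u - v) i • φ (x i))) ≤
      2 * ‖S' - S‖ * (n * κ ^ 2 * (∑ i, y i ^ 2) / ρ ^ 2) := by
  have hG : ∀ a, 0 ≤ a ⬝ᵥ (gram K x *ᵥ a) := fun a => by
    rw [dotProduct_gram_mulVec hK]; exact hS _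
  have hG' : ∀ a, 0 ≤ a ⬝ᵥ (gram K' x *ᵥ a) := fun a => by
    rw [dotProduct_gram_mulVec hK']; exact hS' _
  set R := n * κ ^ 2 * (∑ i, y i ^ 2) / ρ ^ 2
  have hbound : ∀ w : Fin n → ℝ, ρ ^ 2 * ∑ i, w i ^ 2 ≤ ∑ i, y i ^ 2 →
      ‖∑ i, w i • φ (x i)‖ ^ 2 ≤ R := fun w hw => by
    refine (norm_sum_smul_sq_le_of_norm_le hx w).trans ?_
    rw [le_div_iff₀ (by positivity), mul_assoc, mul_comm (∑ i, w i ^ 2)]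
    exact mul_le_mul_of_nonneg_left hw (by positivity)
  have hΦu := hbound u (ridge_norm_le hG' hρ hu)
  have hΦv := hbound v (ridge_norm_le hG hρ hv)
  refine ⟨hΦu, ?_⟩
  have hd : ∑ i, (u - v) i • φ (x i) = ∑ i, u i • φ (x i) - ∑ i, v i • φ (x i) := by
    simp [sub_smul]
  set U := ∑ i, u i • φ (x i)
  set V := ∑ i, v i • φ (x i)
  set W := ∑ i, (u - v) i • φ (x i)
  -- Subtract the two ridge equations and pair with u - v. Dropping the nonnegative ρ-term then
  -- bounds the energy of `W` linearly in ‖S' - S‖.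
  have h1 : inner ℝ W (S W) + ρ * ((u - v) ⬝ᵥ (u - v)) = inner ℝ W ((S - S') U) := by
    have h2 : gram K x *ᵥ (u - v) + ρ • (u - v) = gram K x *ᵥ u - gram K' x *ᵥ u := by
      rw [mulVec_sub, smul_sub]
      have := hu.trans hv.symm
      rw [← sub_eq_zero] at this ⊢
      rw [← this]
      abel_nf
    have h3 := congrArg (fun z => (u - v) ⬝ᵥ z) h2
    rw [dotProduct_add, dotProduct_smul, smul_eq_mul, dotProduct_sub (u - v) (gram K x *ᵥ u),
      dotProduct_gram_mulVec hK, dotProduct_gram_mulVec hK,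
      dotProduct_gram_mulVec hK'] at h3
    rw [_root_.sub_apply, inner_sub_right]
    linarith
  have h4 : 0 ≤ (u - v) ⬝ᵥ (u - v) := Finset.sum_nonneg fun i _ => mul_self_nonneg _
  have h5 : inner ℝ W ((S - S') U) ≤ ‖W‖ * (‖S' - S‖ * ‖U‖) :=
    (real_inner_le_norm _ _).trans (mul_le_mul_of_nonneg_left
      (norm_sub_rev S' S ▸ (S - S').le_opNorm U) (norm_nonneg _))
  have h6 : ‖W‖ ≤ ‖U‖ + ‖V‖ := hd ▸ norm_sub_le _ _
  have h7 : ‖W‖ * ‖U‖ ≤ 2 * R := by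
    have : ‖W‖ * ‖U‖ ≤ (‖U‖ + ‖V‖) * ‖U‖ := mul_le_mul_of_nonneg_right h6 (norm_nonneg _)
    nlinarith [sq_nonneg (‖U‖ - ‖V‖)]
  have h8 := mul_le_mul_of_nonneg_left h7 (norm_nonneg (S' - S))
  have h9 := mul_nonneg hρ.le h4
  linarith

end Ridge

/-! ### The deterministic error bound and the conclusion. -/

section Main

variable {X : Type*} [MeasurableSpace X] {P : Measure X} [IsProbabilityMeasure P]
  {k : X → X → ℝ} {lam : ℕ → ℝ} {e : ℕ → X → ℝ} {κ : ℝ} {c : ℕ → ℝ} {N n : ℕ}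

/-- The deterministic error bound, in terms of the distance of the covariance operators. -/
theorem krr_error_le (hk : IsSpectralExpansion P k lam e) (hκ : ∀ᵐ x ∂P, k x x ≤ κ ^ 2)
    (hc : ∀ p, 0 ≤ c (p + 1)) (hn : 0 < n) {β : ℝ} (hβ : 0 < β) (hN : 0 < N) {x : Fin N → X}
    (h : InsideConvergence c (lamMax k (lam 0) x)) {z : Fin n → X}
    (hz : ∀ i, ‖feature hk (z i)‖ ^ 2 ≤ κ ^ 2) (y : Fin n → ℝ) :
    MemLp (fun w => krr (empiricalStk c k x) β z y w - krr (stk (transform c) lam e) β z y w) 2 P ∧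
    ∫ w, (krr (empiricalStk c k x) β z y w - krr (stk (transform c) lam e) β z y w) ^ 2 ∂P ≤
      8 * transform c (lamMax k (lam 0) x) * quotientSeriesDeriv c (lamMax k (lam 0) x) *
        ‖empiricalCovariance (feature hk) x - covariance P (feature hk)‖ *
        (κ ^ 2 * (∑ i, y i ^ 2) / (n * β ^ 2)) := by
  set L := lamMax k (lam 0) x
  set φ := feature hk
  set T := covariance P φ
  set T' := empiricalCovariance φ x
  set S := quotientSeries c T
  set S' := quotientSeries c T'
  have hnr : (0 : ℝ) < n := Nat.cast_pos.2 hn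
  have hlamL : lam 0 ≤ L := le_max_left _ _
  have hL : 0 ≤ L := (hk.nonneg 0).trans hlamL
  have h0 : InsideConvergence c (lam 0) := h.mono hlamL
  have hT : ‖T‖ ≤ L := (norm_covariance_feature_le hk hκ).trans hlamL
  have hT' : ‖T'‖ ≤ L :=
    (norm_empiricalCovariance_le (inner_feature hk) hN x).trans (le_max_right _ _)
  have hK : ∀ x z, stk (transform c) lam e x z = inner ℝ (φ x) (S (φ z)) :=
    stk_eq_inner hk hκ hc h0
  have hK' : ∀ u w, empiricalStk c k x u w = inner ℝ (φ u) (S' (φ w)) :=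
    empiricalStk_eq_inner (inner_feature hk) hc h hT'
  have hS : ∀ q, 0 ≤ inner ℝ q (S q) := inner_quotientSeries_covariance_nonneg hk hκ hc h0
  have hS' : ∀ q, 0 ≤ inner ℝ q (S' q) :=
    inner_quotientSeries_empiricalCovariance_nonneg hc h hT'
  have hρ : 0 < (n : ℝ) * β := by positivity
  have hG : ∀ a, 0 ≤ a ⬝ᵥ (gram (stk (transform c) lam e) z *ᵥ a) := fun a => by
    rw [dotProduct_gram_mulVec hK]; exact hS _
  have hG' : ∀ a, 0 ≤ a ⬝ᵥ (gram (empiricalStk c k x) z *ᵥ a) := fun a => by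
    rw [dotProduct_gram_mulVec hK']; exact hS' _
  have hv := ridge_solution hG hρ y
  have hu := ridge_solution hG' hρ y
  set v := (gram (stk (transform c) lam e) z + ((n : ℝ) * β) • (1 : Matrix _ _ ℝ))⁻¹ *ᵥ y with hvdef
  set u := (gram (empiricalStk c k x) z + ((n : ℝ) * β) • (1 : Matrix _ _ ℝ))⁻¹ *ᵥ y with hudef
  obtain ⟨hU, hW⟩ := ridge_perturbation hK hK' hS hS' hρ hz hu hv
  have hd : ∑ i, (u - v) i • φ (z i) = ∑ i, u i • φ (z i) - ∑ i, v i • φ (z i) := by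
    simp [sub_smul]
  rw [hd] at hW
  set U := ∑ i, u i • φ (z i)
  set V := ∑ i, v i • φ (z i)
  set a := (S' - S) U
  set b := S (U - V)
  have hf : ∀ w, krr (empiricalStk c k x) β z y w - krr (stk (transform c) lam e) β z y w =
      inner ℝ (φ w) (a + b) := fun w => by
    rw [krr, krr, ← hvdef, ← hudef, kvec_dotProduct hK, kvec_dotProduct hK', ← inner_sub_right]
    congr 1
    simp only [a, b, _root_.sub_apply, map_sub]
    abel
  simp_rw [hf]
  refine ⟨memLp_inner_feature hk hκ _, ?_⟩
  set R := n * κ ^ 2 * (∑ i, y i ^ 2) / (n * β) ^ 2 with hR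
  have hR0 : 0 ≤ R := (sq_nonneg _).trans hU
  set Δ := ‖T' - T‖
  set g' := quotientSeriesDeriv c L
  have hg' : 0 ≤ g' := quotientSeriesDeriv_nonneg hc hL
  have hg : 0 ≤ quotientSeries c L := quotientSeries_nonneg hc hL
  set D := ‖S' - S‖
  have hD0 : 0 ≤ D := norm_nonneg _
  have hD1 : D ≤ g' * Δ := norm_quotientSeries_sub_le hc h hT' hT
  -- Using one factor of D² through this crude bound and the other through `hD1` keeps the estimate
  -- linear in Δ, and L g(L) assembles into s(L).
  have hD2 : D ≤ 2 * quotientSeries c L := by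
    have h1 := norm_quotientSeries_le hc h hT
    have h2 := norm_quotientSeries_le hc h hT'
    exact (norm_sub_le _ _).trans (by linarith)
  have hs : transform c L = L * quotientSeries c L := transform_eq_mul_quotientSeries c L
  have hs0 : 0 ≤ transform c L := hs ▸ mul_nonneg hL hg
  have hquad : ∀ q, ∫ w, inner ℝ (φ w) q ^ 2 ∂P = inner ℝ q (T q) :=
    integral_inner_feature_sq hk hκ
  have hsplit : ∫ w, inner ℝ (φ w) (a + b) ^ 2 ∂P ≤
      2 * inner ℝ a (T a) + 2 * inner ℝ b (T b) := by
    rw [← hquad a, ← hquad b, ← integral_const_mul, ← integral_const_mul, ← integral_add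
      ((memLp_inner_feature hk hκ a).integrable_sq.const_mul 2)
      ((memLp_inner_feature hk hκ b).integrable_sq.const_mul 2)]
    refine integral_mono (memLp_inner_feature hk hκ _).integrable_sq
      (((memLp_inner_feature hk hκ a).integrable_sq.const_mul 2).add
        ((memLp_inner_feature hk hκ b).integrable_sq.const_mul 2)) fun w => ?_
    simp only [inner_add_right]
    nlinarith [sq_nonneg (inner ℝ (φ w) a - inner ℝ (φ w) b)]
  have ha : inner ℝ a (T a) ≤ 2 * transform c L * g' * Δ * R := by
    have h1 : ‖a‖ ^ 2 ≤ D ^ 2 * R := by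
      calc ‖a‖ ^ 2 ≤ (D * ‖U‖) ^ 2 := pow_le_pow_left₀ (norm_nonneg _) ((S' - S).le_opNorm U) 2
        _ = D ^ 2 * ‖U‖ ^ 2 := by ring
        _ ≤ _ := mul_le_mul_of_nonneg_left hU (by positivity)
    have h2 : D ^ 2 ≤ 2 * quotientSeries c L * (g' * Δ) := by
      rw [sq]; exact mul_le_mul hD2 hD1 hD0 (by positivity)
    calc inner ℝ a (T a) ≤ ‖a‖ * (L * ‖a‖) := (real_inner_le_norm _ _).trans
          (mul_le_mul_of_nonneg_left ((T.le_opNorm a).trans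
            (mul_le_mul_of_nonneg_right hT (norm_nonneg _))) (norm_nonneg _))
      _ = L * ‖a‖ ^ 2 := by ring
      _ ≤ L * (D ^ 2 * R) := mul_le_mul_of_nonneg_left h1 hL
      _ ≤ L * ((2 * quotientSeries c L * (g' * Δ)) * R) := by gcongr
      _ = _ := by rw [hs]; ring
  -- Bounding ‖b‖ directly would lose the energy estimate `hW`; STS ≤ s(λ₁)S reduces the term to
  -- exactly that energy.
  have hb : inner ℝ b (T b) ≤ 2 * transform c L * g' * Δ * R := by
    calc inner ℝ b (T b) ≤ transform c (lam 0) * inner ℝ (U - V) (S (U - V)) :=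
          inner_covariance_quotientSeries_le hk hκ hc h0 _
      _ ≤ transform c L * inner ℝ (U - V) (S (U - V)) :=
          mul_le_mul_of_nonneg_right (transform_mono hc h (hk.nonneg 0) hlamL) (hS _)
      _ ≤ transform c L * (2 * D * R) := mul_le_mul_of_nonneg_left hW hs0
      _ ≤ transform c L * (2 * (g' * Δ) * R) := by gcongr
      _ = _ := by ring
  have hRn : R = κ ^ 2 * (∑ i, y i ^ 2) / (n * β ^ 2) := by
    rw [hR]; field_simp
  rw [← hRn]
  -- The constant is 8 = 2·2 + 2·2: `hsplit` doubles each of the bounds `ha` and `hb`.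
  linarith

end Main

end STKR

theorem mainTheorem7 {X : Type*} [MeasurableSpace X] (P : Measure X) [IsProbabilityMeasure P]
    (k : X → X → ℝ) (lam : ℕ → ℝ) (e : ℕ → X → ℝ)
    (hk : STKR.IsSpectralExpansion P k lam e)
    (κ : ℝ) (hκ : ∀ᵐ x ∂P, k x x ≤ κ ^ 2)
    (c : ℕ → ℝ) (hc : ∀ p, 0 ≤ c (p + 1))
    (m n : ℕ) (hn : 0 < n) (β : ℝ) (hβ : 0 < β)
    (δ : ℝ) (hδ₀ : 0 < δ) (hδ₁ : δ < 1) :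
    ∃ E : Set (Fin (m + n) → X), MeasurableSet E ∧
      1 - δ ≤ (Measure.pi fun _ : Fin (m + n) => P).real E ∧
      ∀ x ∈ E, STKR.InsideConvergence c (STKR.lamMax k (lam 0) x) → ∀ y : Fin n → ℝ,
        let s : ℝ → ℝ := STKR.transform c
        let L : ℝ := STKR.lamMax k (lam 0) x
        let fTilde : X → ℝ := STKR.krr (STKR.stk s lam e) β (STKR.labeled x) y
        let fHat : X → ℝ := STKR.krr (STKR.empiricalStk c k x) β (STKR.labeled x) y
        MemLp (fun z => fHat z - fTilde z) 2 P ∧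
        ∫ z, (fHat z - fTilde z) ^ 2 ∂P ≤
          8 * s L * deriv (fun t => s t / t) L
            * ((β ^ 2)⁻¹ * κ ^ 4 / √((m : ℝ) + n))
            * (2 + √(2 * Real.log (1 / δ)))
            * ((∑ i, y i ^ 2) / n) := by
  have hN : 0 < m + n := by omega
  have hnr : (0 : ℝ) < n := Nat.cast_pos.2 hn
  obtain ⟨E, hE, hPE, h⟩ := STKR.exists_norm_empiricalCovariance_sub_le P
    (STKR.stronglyMeasurable_feature hk) (STKR.ae_norm_feature_sq_le hk hκ) hN hδ₀ hδ₁
  refine ⟨E, hE, hPE, fun x hx hconv y => ?_⟩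
  intro s L fTilde fHat
  obtain ⟨hbd, hΔ⟩ := h x hx
  obtain ⟨hmem, hint⟩ := STKR.krr_error_le hk hκ hc hn hβ hN hconv
    (z := STKR.labeled x) (fun i => hbd _) y
  refine ⟨hmem, hint.trans ?_⟩
  have hL : 0 ≤ L := (hk.nonneg 0).trans (le_max_left _ _)
  -- If L = 0 then s(L) = 0 annihilates both sides, whatever value `deriv` takes there.
  rcases hL.eq_or_lt with h0 | hLpos
  · have hs : STKR.transform c L = 0 := by
      rw [STKR.transform_eq_mul_quotientSeries, ← h0, zero_mul]
    change 8 * STKR.transform c L * _ * _ * _ ≤ 8 * STKR.transform c L * _ * _ * _ * _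
    simp [hs]
  · have hder : deriv (fun t => s t / t) L = STKR.quotientSeriesDeriv c L :=
      STKR.deriv_transform_div hc hconv hLpos
    rw [hder]
    have hs0 : 0 ≤ s L := by
      change 0 ≤ STKR.transform c L
      rw [STKR.transform_eq_mul_quotientSeries]
      exact mul_nonneg hL (STKR.quotientSeries_nonneg hc hL)
    have hg0 := STKR.quotientSeriesDeriv_nonneg hc hL
    push_cast at hΔ
    calc _ ≤ 8 * s L * STKR.quotientSeriesDeriv c L *
          (κ ^ 2 / √((m : ℝ) + n) * (2 + √(2 * Real.log (1 / δ)))) *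
          (κ ^ 2 * (∑ i, y i ^ 2) / (n * β ^ 2)) := by
          have hy : 0 ≤ ∑ i, y i ^ 2 := Finset.sum_nonneg fun i _ => sq_nonneg _
          refine mul_le_mul_of_nonneg_right (mul_le_mul_of_nonneg_left hΔ ?_) (by positivity)
          positivity
      _ = _ := by
          field_simp
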